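/- Let $0\le k\le N$ be integers and let $M$ be a random $N\times N$ complex matrix whose law has a density $\rho\ge 0$ with respect to Lebesgue measure on the space $\mathbf M_N$ of $N\times N$ complex matrices (the product of the measures $d\,\mathrm{Re}\,d\,\mathrm{Im}$ of the entries). A $k$-point correlation function of $M$ is an integrable function $\rho^{(k)}_M:\mathbb C^k\to\mathbb R$ such that for every bounded measurable $f:\mathbb C^k\to\mathbb R$ the sum below is integrable and $$\mathbb E\Big[\sum_{i_1,\dots,i_k\ \text{pairwise distinct}} f(\lambda_{i_1},\dots,\lambda_{i_k})\Big]=\int_{\mathbb C^k} f(\mathbf z)\,\rho^{(k)}_M(\mathbf z)\,d\mathbf z ,$$ where $\lambda_1,\dots,\lambda_N$ are the eigenvalues of $M$ with multiplicity. For $n\ge 0$ let $S^n$ denote the unit sphere of $\mathbb C^{n+1}$ and $dS_n$ its unnormalised surface measure. For $\mathbf v\in S^n$ whose first coordinate is real and nonnegative let $R(\mathbf v)$ be the Householder reflection that exchanges $\mathbf v$ and the first coordinate vector $\mathbf e_1$, i.e. $R(\mathbf v)=1-2\mathbf u\mathbf u^*/\|\mathbf u\|^2$ with $\mathbf u=\mathbf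 v-\mathbf e_1$ (and $R(\mathbf e_1)=1$). Extend $R$ to all $\mathbf v\in S^n$ with nonzero first coordinate by $R(e^{i\phi}\mathbf v)=R(\mathbf v)$. Given $\mathbf z\in\mathbb C^k$, $\mathbf v_i\in S^{N-i}$, $\mathbf w_i\in\mathbb C^{N-i}$ ($1\le i\le k$) and $M^{(k)}\in\mathbf M_{N-k}$, define recursively, for $i=k,\dots,1$, with $M_k=M^{(k)}$, $$M_{i-1}=R(\mathbf v_i)\begin{pmatrix} z_i&\mathbf w_i^*\\ 0&M_i\end{pmatrix}R(\mathbf v_i)\in\mathbf M_{N-i+1},$$ and write $\rho(\mathbf z,\mathbf v_1,\mathbf w_1,\dots,\mathbf v_k,\mathbf w_k,M^{(k)}):=\rho(M_0)$. Let $\Delta(\mathbf z)=\prod_{i<j}(z_j-z_i)$. Then for almost every $\mathbf z\in\mathbb C^k$ the integral below converges absolutely, the function $$\frac{|\Delta(\mathbf z)|^2}{(2\pi)^k}\int_{S^{N-1}}\int_{\mathbb C^{N-1}}\cdots\int_{S^{N-k}}\int_{\mathbb C^{N-k}}\int_{\mathbf M_{N-k}}\rho(\mathbf z,\mathbf v_1,\mathbf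 w_1,\dots,\mathbf v_k,\mathbf w_k,M^{(k)})\prod_{i=1}^k\big|\det(z_i-M^{(k)})\big|^2\,dM^{(k)}\,d\mathbf w_k\,dS_{N-k}(\mathbf v_k)\cdots d\mathbf w_1\,dS_{N-1}(\mathbf v_1)$$ of $\mathbf z$ (set equal to $0$ on the null set where the integral diverges) is a $k$-point correlation function of $M$, and every $k$-point correlation function $\rho^{(k)}_M$ of $M$ equals it for almost every $\mathbf z\in\mathbb C^k$. -/

import Mathlib

open MeasureTheory

noncomputable section

/-- The product (Borel) sigma-algebra on complex square matrices. -/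
instance matrixMeasurableSpace (n : ℕ) : MeasurableSpace (Matrix (Fin n) (Fin n) ℂ) :=
  inferInstanceAs (MeasurableSpace (Fin n → Fin n → ℂ))

/-- Lebesgue measure on the space of `n × n` complex matrices: the product of the Lebesgue
measures `d(Re) d(Im)` of the entries. -/
def matrixLebesgue (n : ℕ) : Measure (Matrix (Fin n) (Fin n) ℂ) :=
  (volume : Measure (Fin n → Fin n → ℂ))

/-! ### Eigenvalues and correlation functions -/

/-- The characteristic roots of a complex matrix can be listed with their multiplicities. -/
theorem exists_eigenvalue_tuple {N : ℕ} (A : Matrix (Fin N) (Fin N) ℂ) :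
    ∃ e : Fin N → ℂ, (Finset.univ : Finset (Fin N)).val.map e = A.charpoly.roots := by
  have hcard : A.charpoly.roots.card = N := by
    rw [← (IsAlgClosed.splits A.charpoly).natDegree_eq_card_roots,
      Matrix.charpoly_natDegree_eq_dim, Fintype.card_fin]
  obtain ⟨l, hl⟩ := Quot.exists_rep A.charpoly.roots
  have hl' : (l : Multiset ℂ) = A.charpoly.roots := hl
  have hlen : l.length = N := by rw [← hcard, ← hl']; rfl
  subst hlen
  refine ⟨l.get, ?_⟩
  rw [← hl', Fin.univ_val_map, List.ofFn_get]

/-- The eigenvalues of `A`, repeated according to algebraic multiplicity, in some order. -/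
def eigenvalueTuple {N : ℕ} (A : Matrix (Fin N) (Fin N) ℂ) : Fin N → ℂ :=
  (exists_eigenvalue_tuple A).choose

/-- The sum of `f (z_{i₁}, …, z_{i_k})` over all `k`-tuples of pairwise distinct indices, where
`z₁, …, z_N` are the eigenvalues of `A`. It does not depend on how the eigenvalues are ordered. -/
def eigenvalueSum {N : ℕ} (k : ℕ) (f : (Fin k → ℂ) → ℝ) (A : Matrix (Fin N) (Fin N) ℂ) : ℝ :=
  ∑ σ : Fin k ↪ Fin N, f fun i => eigenvalueTuple A (σ i)

/-- `r` is a `k`-point correlation function of (the eigenvalues of) the random matrix `M`: it is a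
density on `ℂ^k` with `E [∑ f (z_{i₁}, …, z_{i_k})] = ∫ f r` for all bounded measurable `f`, the
sum being over pairwise distinct indices. -/
structure IsCorrelationFunction {Ω : Type*} [MeasurableSpace Ω] (P : Measure Ω) {N : ℕ}
    (M : Ω → Matrix (Fin N) (Fin N) ℂ) (k : ℕ) (r : (Fin k → ℂ) → ℝ) : Prop where
  integrable : Integrable r
  integrable_eigenvalueSum : ∀ f : (Fin k → ℂ) → ℝ, Measurable f → (∃ C, ∀ z, |f z| ≤ C) →
    Integrable (fun ω => eigenvalueSum k f (M ω)) P
  integral_eq : ∀ f : (Fin k → ℂ) → ℝ, Measurable f → (∃ C, ∀ z, |f z| ≤ C) →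
    ∫ ω, eigenvalueSum k f (M ω) ∂P = ∫ z, f z * r z

/-! ### The partial Schur decomposition -/

/-- The unit sphere of `ℂ^n`. -/
abbrev UnitSphere (n : ℕ) : Type := Metric.sphere (0 : EuclideanSpace ℂ (Fin n)) 1

/-- The (unnormalised) surface measure on the unit sphere of `ℂ^n`, of total mass
`2 π^n / (n-1)!` for `n ≥ 1`. -/
def sphereMeasure (n : ℕ) : Measure (UnitSphere n) :=
  ((volume : Measure (Fin n → ℂ)).map (WithLp.toLp 2 : (Fin n → ℂ) → EuclideanSpace ℂ (Fin n))).toSphere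

/-- Multiply `v` by the phase that makes its first coordinate real and nonnegative. -/
def phaseNormalize {n : ℕ} (v : EuclideanSpace ℂ (Fin (n + 1))) :
    EuclideanSpace ℂ (Fin (n + 1)) :=
  if v 0 = 0 then v else ((‖v 0‖ : ℂ) / v 0) • v

/-- The Householder reflection `R(v) = 1 - 2 u u^* / ‖u‖²`, `u = v - e₁`, which for a unit vector
`v` with real nonnegative first coordinate exchanges `v` and the first coordinate vector `e₁`
(it is the identity if `v = e₁`). It is extended to all unit vectors by `R(e^{iφ} v) = R(v)`. -/
def householder {n : ℕ} (v : EuclideanSpace ℂ (Fin (n + 1))) :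
    Matrix (Fin (n + 1)) (Fin (n + 1)) ℂ :=
  let u : EuclideanSpace ℂ (Fin (n + 1)) := phaseNormalize v - EuclideanSpace.single 0 1
  1 - (2 / (‖u‖ : ℂ) ^ 2) • Matrix.vecMulVec u (star (u : Fin (n + 1) → ℂ))

/-- The block matrix `(z, w^*; 0, A)`. -/
def schurBlock {n : ℕ} (z : ℂ) (w : Fin n → ℂ) (A : Matrix (Fin n) (Fin n) ℂ) :
    Matrix (Fin (n + 1)) (Fin (n + 1)) ℂ :=
  Matrix.of (Fin.cons (Fin.cons z (star w)) fun i => Fin.cons 0 (A i))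

/-- One step of the Schur decomposition. -/
def schurStep {n : ℕ} (z : ℂ) (v : UnitSphere (n + 1)) (w : Fin n → ℂ)
    (A : Matrix (Fin n) (Fin n) ℂ) : Matrix (Fin (n + 1)) (Fin (n + 1)) ℂ :=
  householder v.1 * schurBlock z w A * householder v.1

/-- The partial Schur coordinates, other than the eigenvalues, of matrices of size `N = m + k`
after `k` steps: `(v₁, w₁, …, v_k, w_k, M^{(k)})` with `v_i` a unit vector of `ℂ^{N-i+1}`,
`w_i ∈ ℂ^{N-i}` and `M^{(k)}` an `m × m` matrix. -/
def SchurCoord (m : ℕ) : ℕ → Type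
  | 0 => Matrix (Fin m) (Fin m) ℂ
  | k + 1 => UnitSphere (m + k + 1) × (Fin (m + k) → ℂ) × SchurCoord m k

/-- The product sigma-algebra. -/
@[reducible] def SchurCoord.measurableSpace (m : ℕ) : (k : ℕ) → MeasurableSpace (SchurCoord m k)
  | 0 => inferInstanceAs (MeasurableSpace (Matrix (Fin m) (Fin m) ℂ))
  | k + 1 =>
    letI := SchurCoord.measurableSpace m k
    inferInstanceAs
      (MeasurableSpace (UnitSphere (m + k + 1) × (Fin (m + k) → ℂ) × SchurCoord m k))

instance (m k : ℕ) : MeasurableSpace (SchurCoord m k) := SchurCoord.measurableSpace m k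

/-- The product measure `dS(v₁) dw₁ ⋯ dS(v_k) dw_k dM^{(k)}`. -/
def SchurCoord.measure (m : ℕ) : (k : ℕ) → Measure (SchurCoord m k)
  | 0 => matrixLebesgue m
  | k + 1 => (sphereMeasure (m + k + 1)).prod
      ((volume : Measure (Fin (m + k) → ℂ)).prod (SchurCoord.measure m k))

/-- The residual matrix `M^{(k)}`. -/
def SchurCoord.residual {m : ℕ} : {k : ℕ} → SchurCoord m k → Matrix (Fin m) (Fin m) ℂ
  | 0, A => A
  | _ + 1, (_, _, x) => SchurCoord.residual x

/-- The partial Schur map: the matrix with coordinates `(z₁, v₁, w₁, …, z_k, v_k, w_k, M^{(k)})`. -/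
def partialSchur {m : ℕ} : {k : ℕ} → (Fin k → ℂ) → SchurCoord m k →
    Matrix (Fin (m + k)) (Fin (m + k)) ℂ
  | 0, _, A => A
  | _ + 1, z, (v, w, x) => schurStep (z 0) v w (partialSchur (Fin.tail z) x)

/-- `|Δ(z)|²`, the squared modulus of the Vandermonde determinant. -/
def vandermondeNormSq {k : ℕ} (z : Fin k → ℂ) : ℝ :=
  ∏ i, ∏ j ∈ Finset.Ioi i, ‖z j - z i‖ ^ 2

/-- The integrand `ρ(M) ∏ i, |det (z_i - M^{(k)})|²`, in partial Schur coordinates. -/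
def schurIntegrand {m k : ℕ} (ρ : Matrix (Fin (m + k)) (Fin (m + k)) ℂ → ℝ) (z : Fin k → ℂ)
    (x : SchurCoord m k) : ℝ :=
  ρ (partialSchur z x) * ∏ i, ‖(Matrix.scalar (Fin m) (z i) - x.residual).det‖ ^ 2

end

/-! The proof splits off one eigenvector at a time, with an arbitrary measurable `F(z, M) ≥ 0` in
place of `f(z) ρ(M)` so that the step can be iterated. No measurable choice of a Schur decomposition
is needed: the sum over eigenvalues arises as the sum over a fibre in the area formula.

Write a matrix of size n+1 as (a, w; u, B) and fix t = (w, B, a). The vector (1, y) is an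
eigenvector, with eigenvalue z = a + w·y, exactly when u = z y - B y (`borderFill_mulVec_iff`). The
derivative of y ↦ u is z - A with A = B - y wᵀ, and A is also the block that remains once the
eigenvector is split off; the real Jacobian is therefore |det(z - A)|²
(`hasStrictFDerivAt_borderColumn`). For almost every t no eigenvector of B is killed by w
(`ae_isObservable`), and almost every u is a regular value; then the fibre over u is in bijection
with the eigenvalues (`tsum_fiber_borderColumn`). Since (w, B, a) ↦ (w, A, z) preserves Lebesgue
measure for fixed y, the area formula and Tonelli give the splitting in the affine chart y, with
unipotent matrices in place of reflections (`lintegral_tupleSum_eigenvalueTuple`).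

To pass to the sphere, factor R(v) = shear(y) U with U block upper triangular and y the affine
coordinates of v. Conjugation by U contributes |v₀|^(2n+2)
(`lintegral_deflatedIntegrand_householder`), while v ↦ y carries dS to 2π |v₀|^(2n+2) dy
(`lintegral_sphereMeasure_affineCoord`). The powers cancel and each step costs one factor 2π
(`lintegral_tupleSum_schurStep`).

On iteration, the weight |det(z - A)|² is evaluated on a matrix A that is itself in Schur form, so
it factors into the differences |z - z'ᵢ|², which build up the Vandermonde factor, and the
characteristic polynomial of the residual (`schurLIntegrand_succ`,
`lintegral_tupleSum_partialSchur`). Taking F = f ρ proves the identity for f ≥ 0. The case f = 1 has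
finite mass, which gives almost everywhere convergence and integrability; bounded f follow by adding
a constant, and uniqueness by testing on indicators. -/

noncomputable section

/-! ### The area formula -/

open Set in
/-- A strictly differentiable map is injective on each of countably many open sets that cover the
points where its differential is invertible. -/
theorem exists_countable_injOn_cover {E : Type*} [NormedAddCommGroup E] [NormedSpace ℝ E]
    [FiniteDimensional ℝ E] {f : E → E} {f' : E → E →L[ℝ] E}
    (hf : ∀ x, HasStrictFDerivAt f (f' x) x) :
    ∃ t : ℕ → Set E, (∀ i, IsOpen (t i)) ∧ (∀ i, InjOn f (t i)) ∧
      ∀ x, (f' x).det ≠ 0 → ∃ i, x ∈ t i := by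
  have : CompleteSpace E := FiniteDimensional.complete ℝ E
  have : ProperSpace E := FiniteDimensional.proper ℝ E
  -- The empty set is added so that the countable family is nonempty and hence the range of a
  -- sequence.
  set S : Set (Set E) := {t | t ∈ TopologicalSpace.countableBasis E ∧ InjOn f t} ∪ {∅} with hS
  have hc : S.Countable :=
    (((TopologicalSpace.countable_countableBasis E).mono fun t ht => ht.1)).union
      (countable_singleton _)
  obtain ⟨t, ht⟩ := hc.exists_eq_range ⟨∅, Or.inr rfl⟩
  have hmem : ∀ i, t i ∈ S := fun i => ht ▸ mem_range_self i
  refine ⟨t, fun i => ?_, fun i => ?_, fun x hx => ?_⟩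
  · rcases hmem i with h | h
    · exact TopologicalSpace.isOpen_of_mem_countableBasis h.1
    · rw [show t i = ∅ from h]; exact isOpen_empty
  · rcases hmem i with h | h
    · exact h.2
    · rw [show t i = ∅ from h]; exact injOn_empty f
  · have h1 : HasStrictFDerivAt f
        ((f' x).toContinuousLinearEquivOfDetNeZero hx : E →L[ℝ] E) x := by
      rw [ContinuousLinearMap.coe_toContinuousLinearEquivOfDetNeZero]; exact hf x
    set e := h1.toOpenPartialHomeomorph f
    have hxe : x ∈ e.source := h1.mem_toOpenPartialHomeomorph_source
    obtain ⟨u, hu, hxu, hue⟩ :=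
      (TopologicalSpace.isBasis_countableBasis E).exists_subset_of_mem_open hxe e.open_source
    have hinj : InjOn f u := by
      have := e.injOn.mono hue
      rwa [h1.toOpenPartialHomeomorph_coe] at this
    have : u ∈ S := Or.inl ⟨hu, hinj⟩
    rw [ht] at this
    obtain ⟨i, rfl⟩ := this
    exact ⟨i, hxu⟩

open Set in
/-- Change of variables on a set of injectivity, with the inverse written as a sum over the
fibre. -/
theorem lintegral_tsum_fiber_of_injOn {E : Type*} [NormedAddCommGroup E] [NormedSpace ℝ E]
    [FiniteDimensional ℝ E] [MeasurableSpace E] [BorelSpace E] (μ : Measure E) [μ.IsAddHaarMeasure]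
    {f : E → E} {f' : E → E →L[ℝ] E} (hf : ∀ x, HasFDerivAt f (f' x) x)
    {s : Set E} (hs : MeasurableSet s) (hinj : InjOn f s) {h : E → ENNReal} (hh : Measurable h) :
    Measurable (fun u => ∑' x : f ⁻¹' {u}, s.indicator h x) ∧
      ∫⁻ x in s, ENNReal.ofReal |(f' x).det| * h x ∂μ =
        ∫⁻ u, ∑' x : f ⁻¹' {u}, s.indicator h x ∂μ := by
  set g : E → ENNReal := fun u => ∑' x : f ⁻¹' {u}, s.indicator h x with hg
  have hg1 : ∀ x ∈ s, g (f x) = h x := by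
    intro x hx
    have : g (f x) = s.indicator h ((⟨x, rfl⟩ : f ⁻¹' {f x}) : E) := by
      refine tsum_eq_single (⟨x, rfl⟩ : f ⁻¹' {f x}) fun y hy => ?_
      by_contra hne
      have hys : (y : E) ∈ s := mem_of_indicator_ne_zero hne
      exact hy (Subtype.ext (hinj hys hx y.2))
    rw [this, indicator_of_mem hx]
  have hg0 : ∀ u, u ∉ f '' s → g u = 0 := by
    intro u hu
    refine ENNReal.tsum_eq_zero.2 fun y => indicator_of_notMem (fun hy => hu ⟨y, hy, y.2⟩) _
  have hemb : MeasurableEmbedding (s.domRestrict f) :=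
    measurableEmbedding_of_fderivWithin hs (fun x _ => (hf x).hasFDerivWithinAt) hinj
  -- On a set of injectivity the fibre sum has at most one nonzero term, so it is the extension by
  -- zero of `h` along a measurable embedding; this is where its measurability comes from.
  have hgext : g = Function.extend (s.domRestrict f) (fun x : s => h x) 0 := by
    funext u
    by_cases hu : u ∈ f '' s
    · obtain ⟨x, hx, rfl⟩ := hu
      rw [hg1 x hx]
      exact (hemb.injective.extend_apply (fun x : s => h x) 0 ⟨x, hx⟩).symm
    · rw [hg0 u hu, Function.extend_apply']
      · rfl
      · rintro ⟨x, rfl⟩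
        exact hu ⟨x, x.2, rfl⟩
  refine ⟨?_, ?_⟩
  · rw [hgext]
    exact hemb.measurable_extend (hh.comp measurable_subtype_coe) measurable_const
  · have hm : MeasurableSet (f '' s) :=
      measurable_image_of_fderivWithin hs (fun x _ => (hf x).hasFDerivWithinAt) hinj
    calc _ = ∫⁻ x in s, ENNReal.ofReal |(f' x).det| * g (f x) ∂μ :=
          setLIntegral_congr_fun hs fun x hx => by rw [hg1 x hx]
      _ = ∫⁻ u in f '' s, g u ∂μ :=
          (lintegral_image_eq_lintegral_abs_det_fderiv_mul μ hs
            (fun x _ => (hf x).hasFDerivWithinAt) hinj g).symm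
      _ = ∫⁻ u, g u ∂μ := by
          rw [← lintegral_indicator hm]
          congr 1; funext u
          by_cases hu : u ∈ f '' s
          · rw [indicator_of_mem hu]
          · rw [indicator_of_notMem hu, hg0 u hu]

/-- Almost every value is regular. -/
theorem ae_det_ne_zero_of_eq {E : Type*} [NormedAddCommGroup E] [NormedSpace ℝ E]
    [FiniteDimensional ℝ E] [MeasurableSpace E] [BorelSpace E] (μ : Measure E) [μ.IsAddHaarMeasure]
    {f : E → E} {f' : E → E →L[ℝ] E} (hf : ∀ x, HasFDerivAt f (f' x) x) :
    ∀ᵐ u ∂μ, ∀ x, f x = u → (f' x).det ≠ 0 := by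
  have := addHaar_image_eq_zero_of_det_fderivWithin_eq_zero μ (s := {x | (f' x).det = 0})
    (fun x _ => (hf x).hasFDerivWithinAt) fun x hx => hx
  rw [measure_eq_zero_iff_ae_notMem] at this
  filter_upwards [this] with u hu x hx h0
  exact hu ⟨x, h0, hx⟩

open Set in
/-- The area formula for a strictly differentiable map between spaces of the same dimension. -/
theorem lintegral_det_mul_eq_lintegral_tsum_fiber {E : Type*} [NormedAddCommGroup E]
    [NormedSpace ℝ E] [FiniteDimensional ℝ E] [MeasurableSpace E] [BorelSpace E] (μ : Measure E)
    [μ.IsAddHaarMeasure] {f : E → E} {f' : E → E →L[ℝ] E}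
    (hf : ∀ x, HasStrictFDerivAt f (f' x) x) (hf' : Measurable fun x => (f' x).det)
    {h : E → ENNReal} (hh : Measurable h) :
    ∫⁻ x, ENNReal.ofReal |(f' x).det| * h x ∂μ = ∫⁻ u, ∑' x : f ⁻¹' {u}, h x ∂μ := by
  obtain ⟨t, hto, hti, htc⟩ := exists_countable_injOn_cover hf
  have hd : ∀ x, HasFDerivAt f (f' x) x := fun x => (hf x).hasFDerivAt
  -- Critical points may be discarded: on the left the Jacobian vanishes there, on the right their
  -- image is null by Sard.
  set s : ℕ → Set E := fun i => disjointed t i ∩ {x | (f' x).det ≠ 0} with hs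
  have hreg : MeasurableSet {x | (f' x).det ≠ 0} := hf' (measurableSet_singleton 0).compl
  have hsm : ∀ i, MeasurableSet (s i) := fun i =>
    (MeasurableSet.disjointed (fun j => (hto j).measurableSet) i).inter hreg
  have hsi : ∀ i, InjOn f (s i) := fun i =>
    (hti i).mono (inter_subset_left.trans (disjointed_subset t i))
  have hsd : Pairwise (Function.onFun Disjoint s) := fun i j hij =>
    (disjoint_disjointed t hij).mono inter_subset_left inter_subset_left
  have hsU : ⋃ i, s i = {x | (f' x).det ≠ 0} := by
    rw [hs, ← iUnion_inter, iUnion_disjointed]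
    refine inter_eq_right.2 fun x hx => mem_iUnion.2 (htc x hx)
  calc ∫⁻ x, ENNReal.ofReal |(f' x).det| * h x ∂μ
      = ∫⁻ x in ⋃ i, s i, ENNReal.ofReal |(f' x).det| * h x ∂μ := by
        rw [hsU, ← lintegral_indicator hreg]
        congr 1; funext x
        by_cases hx : (f' x).det = 0
        · simp [hx]
        · rw [indicator_of_mem (by exact hx)]
    _ = ∑' i, ∫⁻ x in s i, ENNReal.ofReal |(f' x).det| * h x ∂μ :=
        lintegral_iUnion hsm hsd _
    _ = ∑' i, ∫⁻ u, ∑' x : f ⁻¹' {u}, (s i).indicator h x ∂μ :=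
        tsum_congr fun i => (lintegral_tsum_fiber_of_injOn μ hd (hsm i) (hsi i) hh).2
    _ = ∫⁻ u, ∑' i, ∑' x : f ⁻¹' {u}, (s i).indicator h x ∂μ :=
        (lintegral_tsum fun i =>
          (lintegral_tsum_fiber_of_injOn μ hd (hsm i) (hsi i) hh).1.aemeasurable).symm
    _ = ∫⁻ u, ∑' x : f ⁻¹' {u}, h x ∂μ := by
        refine lintegral_congr_ae ?_
        filter_upwards [ae_det_ne_zero_of_eq μ hd] with u hu
        rw [ENNReal.tsum_comm]
        refine tsum_congr fun x => ?_
        have hx : (x : E) ∈ ⋃ i, s i := by rw [hsU]; exact hu x x.2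
        obtain ⟨i, hi⟩ := mem_iUnion.1 hx
        rw [tsum_eq_single i fun j hj => indicator_of_notMem
          (fun hxj => (hsd hj).le_bot ⟨hxj, hi⟩) _, indicator_of_mem hi]

/-! ### Complex-linear maps as real-linear maps -/

/-- The real determinant is the norm from ℂ to ℝ of the complex one. Every squared modulus in the
Jacobians comes from here. -/
theorem det_restrictScalars_complex {E : Type*} [AddCommGroup E] [Module ℂ E]
    [Module.Finite ℂ E] (f : E →ₗ[ℂ] E) :
    LinearMap.det (f.restrictScalars ℝ) = ‖LinearMap.det f‖ ^ 2 := by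
  rw [LinearMap.det_restrictScalars, Algebra.norm_complex_apply, Complex.normSq_eq_norm_sq]

/-- The linear change of variables formula for a complex-linear map. -/
theorem lintegral_comp_complexLinear {E : Type*} [NormedAddCommGroup E] [NormedSpace ℂ E]
    [FiniteDimensional ℂ E] [MeasurableSpace E] [BorelSpace E] (μ : Measure E)
    [μ.IsAddHaarMeasure] (f : E →ₗ[ℂ] E) (hf : LinearMap.det f ≠ 0) {g : E → ENNReal}
    (hg : Measurable g) :
    ENNReal.ofReal (‖LinearMap.det f‖ ^ 2) * ∫⁻ x, g (f x) ∂μ = ∫⁻ x, g x ∂μ := by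
  have : FiniteDimensional ℝ E := FiniteDimensional.complexToReal E
  have hdet := det_restrictScalars_complex f
  have hpos : 0 < ‖LinearMap.det f‖ ^ 2 := by positivity
  have hne : LinearMap.det (f.restrictScalars ℝ) ≠ 0 := by rw [hdet]; exact hpos.ne'
  have hm := Measure.map_linearMap_addHaar_eq_smul_addHaar μ hne
  have hfm : Measurable f := (LinearMap.continuous_of_finiteDimensional f).measurable
  have h1 : ∫⁻ x, g (f x) ∂μ = ENNReal.ofReal |(‖LinearMap.det f‖ ^ 2)⁻¹| * ∫⁻ x, g x ∂μ := by
    rw [← lintegral_map hg hfm, ← hdet, ← smul_eq_mul, ← lintegral_smul_measure, ← hm]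
    rfl
  rw [h1, ← mul_assoc, ← ENNReal.ofReal_mul hpos.le, abs_of_pos (inv_pos.2 hpos),
    mul_inv_cancel₀ hpos.ne', ENNReal.ofReal_one, one_mul]

/-! ### Symmetric sums over eigenvalues -/

instance matrixBorelSpace (n : ℕ) : BorelSpace (Matrix (Fin n) (Fin n) ℂ) :=
  inferInstanceAs (BorelSpace (Fin n → Fin n → ℂ))

instance matrixSecondCountableTopology (n : ℕ) :
    SecondCountableTopology (Matrix (Fin n) (Fin n) ℂ) :=
  inferInstanceAs (SecondCountableTopology (Fin n → Fin n → ℂ))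

instance matrixStandardBorelSpace (n : ℕ) : StandardBorelSpace (Matrix (Fin n) (Fin n) ℂ) :=
  inferInstanceAs (StandardBorelSpace (Fin n → Fin n → ℂ))

/-- Two tuples with the same multiset of values differ by a permutation. -/
theorem exists_perm_of_univ_map_eq {n : ℕ} {α : Type*} {e e' : Fin n → α}
    (h : (Finset.univ : Finset (Fin n)).val.map e = (Finset.univ : Finset (Fin n)).val.map e') :
    ∃ π : Equiv.Perm (Fin n), e' = e ∘ π := by
  classical
  have hcard : ∀ a, Fintype.card {i // e' i = a} = Fintype.card {i // e i = a} := fun a => by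
    have := congrArg (Multiset.count a) h
    rw [Multiset.count_map, Multiset.count_map] at this
    rw [Fintype.card_subtype, Fintype.card_subtype]
    simpa [Finset.card, Finset.filter_val, eq_comm] using this.symm
  let E : ∀ a, {i // e' i = a} ≃ {i // e i = a} := fun a => Fintype.equivOfCardEq (hcard a)
  refine ⟨(Equiv.sigmaFiberEquiv e').symm.trans
    ((Equiv.sigmaCongrRight E).trans (Equiv.sigmaFiberEquiv e)), funext fun i => ?_⟩
  exact (E (e' i) ⟨i, rfl⟩).2.symm

/-- The sum of `F` over the `k`-tuples of entries of `e` with distinct indices. -/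
def tupleSum {n : ℕ} {α β : Type*} [AddCommMonoid β] (k : ℕ) (F : (Fin k → α) → β)
    (e : Fin n → α) : β :=
  ∑ σ : Fin k ↪ Fin n, F fun i => e (σ i)

/-- A permutation of the entries permutes the embeddings, so the arbitrary order chosen in
`eigenvalueTuple` is harmless. -/
theorem tupleSum_congr {n k : ℕ} {α β : Type*} [AddCommMonoid β] (F : (Fin k → α) → β)
    {e e' : Fin n → α}
    (h : (Finset.univ : Finset (Fin n)).val.map e = (Finset.univ : Finset (Fin n)).val.map e') :
    tupleSum k F e = tupleSum k F e' := by
  obtain ⟨π, rfl⟩ := exists_perm_of_univ_map_eq h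
  exact (Equiv.sum_comp (Equiv.embeddingCongr (Equiv.refl (Fin k)) π)
    fun σ : Fin k ↪ Fin n => F fun i => e (σ i)).symm

/-- Splitting off the first entry. -/
theorem tupleSum_succ {n k : ℕ} {α β : Type*} [AddCommMonoid β] (F : (Fin (k + 1) → α) → β)
    (e : Fin (n + 1) → α) :
    tupleSum (k + 1) F e =
      ∑ i, tupleSum k (fun z => F (Fin.cons (e i) z)) fun j => e (i.succAbove j) := by
  unfold tupleSum
  let Φ : (Σ _ : Fin (n + 1), Fin k ↪ Fin n) → (Fin (k + 1) ↪ Fin (n + 1)) := fun p =>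
    ⟨Fin.cons p.1 fun j => p.1.succAbove (p.2 j), Fin.cons_injective_iff.2
      ⟨fun ⟨j, hj⟩ => Fin.succAbove_ne _ _ hj,
        Fin.succAbove_right_injective.comp p.2.injective⟩⟩
  have hΦ : Function.Bijective Φ := by
    constructor
    · rintro ⟨i, σ⟩ ⟨i', σ'⟩ h
      have h0 : i = i' := DFunLike.congr_fun h 0
      subst h0
      refine Sigma.ext rfl (heq_of_eq (DFunLike.ext _ _ fun j => ?_))
      exact Fin.succAbove_right_injective (DFunLike.congr_fun h j.succ :)
    · intro τ
      have hτ : ∀ j : Fin k, ∃ l, (τ 0).succAbove l = τ j.succ := fun j =>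
        Fin.exists_succAbove_eq fun h => Fin.succ_ne_zero j (τ.injective h)
      choose l hl using hτ
      refine ⟨⟨τ 0, ⟨l, fun a b hab => ?_⟩⟩, DFunLike.ext _ _ fun j => ?_⟩
      · exact Fin.succ_injective _ (τ.injective (by rw [← hl, ← hl, hab]))
      · refine Fin.cases rfl (fun j => hl j) j
  rw [← Fintype.sum_sigma', ← Fintype.sum_bijective Φ hΦ _ _ fun p => ?_]
  exact congrArg F (funext fun j => Fin.cases rfl (fun j => rfl) j)

/-- Two complex polynomials with the same values are equal. The pointwise form is a closed condition
on the pair (A, e), and it behaves well under conjugation and block triangular expansion. -/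
theorem charpoly_roots_eq_iff {n : ℕ} (A : Matrix (Fin n) (Fin n) ℂ) (e : Fin n → ℂ) :
    (Finset.univ : Finset (Fin n)).val.map e = A.charpoly.roots ↔
      ∀ z : ℂ, (Matrix.scalar (Fin n) z - A).det = ∏ i, (z - e i) := by
  constructor
  · intro h z
    rw [← Matrix.eval_charpoly, (IsAlgClosed.splits A.charpoly).eq_prod_roots_of_monic
      A.charpoly_monic, ← h, Polynomial.eval_multiset_prod, Multiset.map_map, Multiset.map_map]
    simp [Finset.prod]
  · intro h
    have : A.charpoly = ∏ i, (Polynomial.X - Polynomial.C (e i)) := by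
      refine Polynomial.funext fun z => ?_
      rw [Matrix.eval_charpoly, h, Polynomial.eval_prod]
      simp
    rw [this, Polynomial.roots_prod _ _
      (Finset.prod_ne_zero_iff.2 fun i _ => Polynomial.X_sub_C_ne_zero _)]
    simp [Multiset.bind_singleton]

/-- The choice `eigenvalueTuple` need not be measurable. The sum is instead pulled back to the
closed set of pairs (A, e) with e a list of the eigenvalues of A, where it is a measurable
expression in e. -/
theorem measurable_tupleSum_eigenvalueTuple {n k : ℕ} {γ : Type*} [MeasurableSpace γ]
    [StandardBorelSpace γ] {β : Type*} [AddCommMonoid β] [MeasurableSpace β] [MeasurableAdd₂ β]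
    {F : γ → (Fin k → ℂ) → β} (hF : Measurable (Function.uncurry F)) :
    Measurable fun p : γ × Matrix (Fin n) (Fin n) ℂ =>
      tupleSum k (F p.1) (eigenvalueTuple p.2) := by
  set C : Set (Matrix (Fin n) (Fin n) ℂ × (Fin n → ℂ)) :=
    {q | ∀ z : ℂ, (Matrix.scalar (Fin n) z - q.1).det = ∏ i, (z - q.2 i)} with hC
  have hCc : IsClosed C := by
    rw [hC, Set.ofPred_forall]
    refine isClosed_iInter fun z => isClosed_eq ?_ ?_
    · fun_prop
    · fun_prop
  have : StandardBorelSpace C := hCc.measurableSet.standardBorel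
  let φ : γ × C → γ × Matrix (Fin n) (Fin n) ℂ := fun p => (p.1, p.2.1.1)
  have hφ : Measurable φ := by fun_prop
  have hsurj : Function.Surjective φ := fun ⟨c, A⟩ =>
    ⟨(c, ⟨(A, eigenvalueTuple A), (charpoly_roots_eq_iff A _).1
      (exists_eigenvalue_tuple A).choose_spec⟩), rfl⟩
  -- Between standard Borel spaces, measurability descends along a measurable surjection.
  rw [← hφ.measurable_comp_iff_of_surjective hsurj]
  have : (fun p : γ × Matrix (Fin n) (Fin n) ℂ => tupleSum k (F p.1) (eigenvalueTuple p.2)) ∘ φ =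
      fun p => tupleSum k (F p.1) p.2.1.2 := by
    funext p
    refine tupleSum_congr _ ?_
    rw [(charpoly_roots_eq_iff _ _).2 p.2.2]
    exact (exists_eigenvalue_tuple p.2.1.1).choose_spec
  rw [this]
  unfold tupleSum
  refine Finset.measurable_fun_sum _ fun σ _ => ?_
  have : Measurable fun p : γ × C => (p.1, fun i => p.2.1.2 (σ i)) := by fun_prop
  exact hF.comp this

theorem Measurable.tupleSum_eigenvalueTuple {n k : ℕ} {γ : Type*} [MeasurableSpace γ]
    [StandardBorelSpace γ] {β : Type*} [AddCommMonoid β] [MeasurableSpace β] [MeasurableAdd₂ β]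
    {F : γ → (Fin k → ℂ) → β} (hF : Measurable (Function.uncurry F))
    {A : γ → Matrix (Fin n) (Fin n) ℂ} (hA : Measurable A) :
    Measurable fun x => tupleSum k (F x) (eigenvalueTuple (A x)) := by
  have h : Measurable fun x => (x, A x) := measurable_id.prodMk hA
  exact (measurable_tupleSum_eigenvalueTuple hF).comp h

/-! ### Bordered matrices -/

/-- The block matrix `(a, w; u, B)`. -/
def borderedMatrix {n : ℕ} (a : ℂ) (w u : Fin n → ℂ) (B : Matrix (Fin n) (Fin n) ℂ) :
    Matrix (Fin (n + 1)) (Fin (n + 1)) ℂ :=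
  Matrix.of (Fin.cons (Fin.cons a w) fun i => Fin.cons (u i) (B i))

theorem schurBlock_eq {n : ℕ} (z : ℂ) (w : Fin n → ℂ) (A : Matrix (Fin n) (Fin n) ℂ) :
    schurBlock z w A = borderedMatrix z (star w) 0 A := rfl

section

variable {n : ℕ} (a : ℂ) (w u : Fin n → ℂ) (B : Matrix (Fin n) (Fin n) ℂ)

@[simp] theorem borderedMatrix_zero_zero : borderedMatrix a w u B 0 0 = a := rfl
@[simp] theorem borderedMatrix_zero_succ (j : Fin n) : borderedMatrix a w u B 0 j.succ = w j := rfl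
@[simp] theorem borderedMatrix_succ_zero (i : Fin n) : borderedMatrix a w u B i.succ 0 = u i := rfl
@[simp] theorem borderedMatrix_succ_succ (i j : Fin n) :
    borderedMatrix a w u B i.succ j.succ = B i j := rfl

end

open Matrix

theorem borderedMatrix_ext {n : ℕ} {M M' : Matrix (Fin (n + 1)) (Fin (n + 1)) ℂ}
    (h₁ : M 0 0 = M' 0 0) (h₂ : ∀ j : Fin n, M 0 j.succ = M' 0 j.succ)
    (h₃ : ∀ i : Fin n, M i.succ 0 = M' i.succ 0)
    (h₄ : ∀ i j : Fin n, M i.succ j.succ = M' i.succ j.succ) : M = M' := by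
  ext i j
  refine Fin.cases ?_ (fun i => ?_) i <;> refine Fin.cases ?_ (fun j => ?_) j
  exacts [h₁, h₂ j, h₃ i, h₄ i j]

theorem eq_borderedMatrix {n : ℕ} (M : Matrix (Fin (n + 1)) (Fin (n + 1)) ℂ) :
    M = borderedMatrix (M 0 0) (fun j => M 0 j.succ) (fun i => M i.succ 0)
      (M.submatrix Fin.succ Fin.succ) :=
  borderedMatrix_ext rfl (fun _ => rfl) (fun _ => rfl) fun _ _ => rfl

theorem borderedMatrix_mul {n : ℕ} (a a' : ℂ) (w w' u u' : Fin n → ℂ)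
    (B B' : Matrix (Fin n) (Fin n) ℂ) :
    borderedMatrix a w u B * borderedMatrix a' w' u' B' =
      borderedMatrix (a * a' + w ⬝ᵥ u') (a • w' + w ᵥ* B') (a' • u + B *ᵥ u')
        (vecMulVec u w' + B * B') := by
  refine borderedMatrix_ext ?_ (fun j => ?_) (fun i => ?_) fun i j => ?_ <;>
    simp [Matrix.mul_apply, Fin.sum_univ_succ, dotProduct, vecMul, mulVec, vecMulVec, mul_comm]

theorem borderedMatrix_mulVec {n : ℕ} (a : ℂ) (w u : Fin n → ℂ) (B : Matrix (Fin n) (Fin n) ℂ)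
    (c : ℂ) (x : Fin n → ℂ) :
    borderedMatrix a w u B *ᵥ Fin.cons c x =
      (Fin.cons (a * c + w ⬝ᵥ x) (c • u + B *ᵥ x) : Fin (n + 1) → ℂ) := by
  funext i
  refine Fin.cases ?_ (fun i => ?_) i <;>
    simp [mulVec, dotProduct, Fin.sum_univ_succ, mul_comm]

theorem borderedMatrix_one {n : ℕ} : borderedMatrix 1 0 0 (1 : Matrix (Fin n) (Fin n) ℂ) = 1 := by
  refine borderedMatrix_ext ?_ (fun j => ?_) (fun i => ?_) fun i j => ?_ <;>
    simp [Matrix.one_apply, Fin.succ_ne_zero, (Fin.succ_ne_zero _).symm]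

theorem det_borderedMatrix {n : ℕ} (a : ℂ) (w : Fin n → ℂ) (B : Matrix (Fin n) (Fin n) ℂ) :
    (borderedMatrix a w 0 B).det = a * B.det := by
  rw [det_succ_column_zero, Fin.sum_univ_succ]
  simp
  left
  congr 1

theorem det_scalar_sub_borderedMatrix {n : ℕ} (z a : ℂ) (w : Fin n → ℂ)
    (B : Matrix (Fin n) (Fin n) ℂ) :
    (scalar (Fin (n + 1)) z - borderedMatrix a w 0 B).det =
      (z - a) * (scalar (Fin n) z - B).det := by
  rw [← det_borderedMatrix (z - a) (-w)]
  congr 1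
  refine borderedMatrix_ext ?_ (fun j => ?_) (fun i => ?_) fun i j => ?_ <;>
    simp [scalar_apply, diagonal_apply, Fin.succ_ne_zero, (Fin.succ_ne_zero _).symm]

/-- The unipotent matrix `(1, 0; y, 1)`. -/
def shear {n : ℕ} (y : Fin n → ℂ) : Matrix (Fin (n + 1)) (Fin (n + 1)) ℂ := borderedMatrix 1 0 y 1

theorem shear_mul_shear_neg {n : ℕ} (y : Fin n → ℂ) : shear y * shear (-y) = 1 := by
  rw [shear, shear, borderedMatrix_mul, ← borderedMatrix_one]
  simp

theorem shear_neg_mul_shear {n : ℕ} (y : Fin n → ℂ) : shear (-y) * shear y = 1 := by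
  simpa using shear_mul_shear_neg (-y)

/-- Read from right to left, this splits off the eigenvector (1, y). The lower left entry is left as
a y + (w·y) y - B y, with a and B the new corner and block, to match `borderColumn`. -/
theorem shear_conj {n : ℕ} (y : Fin n → ℂ) (z : ℂ) (w : Fin n → ℂ)
    (A : Matrix (Fin n) (Fin n) ℂ) :
    shear y * borderedMatrix z w 0 A * shear (-y) =
      borderedMatrix (z - w ⬝ᵥ y) w ((z - w ⬝ᵥ y) • y + (w ⬝ᵥ y) • y - (A + vecMulVec y w) *ᵥ y)
        (A + vecMulVec y w) := by
  rw [shear, shear, borderedMatrix_mul, borderedMatrix_mul]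
  congr 1
  · simp [sub_eq_add_neg]
  · simp
  · simp [mulVec_neg, ← add_smul, add_mulVec, sub_eq_add_neg, add_comm]
  · simp [add_comm]

theorem det_conj_eq {n : ℕ} {S T : Matrix (Fin n) (Fin n) ℂ} (h : S * T = 1)
    (A : Matrix (Fin n) (Fin n) ℂ) (z : ℂ) :
    (scalar (Fin n) z - S * A * T).det = (scalar (Fin n) z - A).det := by
  have : scalar (Fin n) z - S * A * T = S * (scalar (Fin n) z - A) * T := by
    rw [mul_sub, sub_mul]
    congr 1
    rw [(scalar_commute z (fun _ => Commute.all _ _) S).symm.eq, mul_assoc, h, mul_one]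
  rw [this, det_mul, det_mul, mul_right_comm, ← det_mul, h, det_one, one_mul]

/-! ### Lebesgue measure on bordered matrices -/

theorem measurable_matrix_iff {n : ℕ} {X : Type*} [MeasurableSpace X]
    {f : X → Matrix (Fin n) (Fin n) ℂ} : Measurable f ↔ ∀ i j, Measurable fun x => f x i j := by
  refine (measurable_pi_iff (X := fun _ : Fin n => Fin n → ℂ)).trans
    (forall_congr' fun i => measurable_pi_iff)

theorem Measurable.matrix_apply {n : ℕ} {X : Type*} [MeasurableSpace X]
    {f : X → Matrix (Fin n) (Fin n) ℂ} (hf : Measurable f) (i j : Fin n) :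
    Measurable fun x => f x i j :=
  measurable_matrix_iff.1 hf i j

@[fun_prop]
theorem Measurable.borderedMatrix {n : ℕ} {X : Type*} [MeasurableSpace X] {a : X → ℂ}
    {w u : X → Fin n → ℂ} {B : X → Matrix (Fin n) (Fin n) ℂ} (ha : Measurable a)
    (hw : Measurable w) (hu : Measurable u) (hB : Measurable B) :
    Measurable fun x => _root_.borderedMatrix (a x) (w x) (u x) (B x) := by
  refine measurable_matrix_iff.2 fun i j => ?_
  refine Fin.cases ?_ (fun i => ?_) i <;> refine Fin.cases ?_ (fun j => ?_) j <;>
    simp only [borderedMatrix_zero_zero, borderedMatrix_zero_succ, borderedMatrix_succ_zero,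
      borderedMatrix_succ_succ]
  exacts [ha, by fun_prop, by fun_prop, hB.matrix_apply i j]

@[fun_prop]
theorem Measurable.matrix_mul {n : ℕ} {X : Type*} [MeasurableSpace X]
    {f g : X → Matrix (Fin n) (Fin n) ℂ} (hf : Measurable f) (hg : Measurable g) :
    Measurable fun x => f x * g x := by
  have : Continuous fun p : Matrix (Fin n) (Fin n) ℂ × Matrix (Fin n) (Fin n) ℂ => p.1 * p.2 := by
    fun_prop
  exact this.measurable.comp (hf.prodMk hg)

@[fun_prop]
theorem Measurable.shear {n : ℕ} {X : Type*} [MeasurableSpace X] {y : X → Fin n → ℂ}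
    (hy : Measurable y) : Measurable fun x => _root_.shear (y x) := by
  unfold _root_.shear
  fun_prop

/-- The entries of a bordered matrix, the first column apart. -/
abbrev BorderCoord (n : ℕ) : Type := (Fin n → ℂ) × Matrix (Fin n) (Fin n) ℂ × ℂ

instance (n : ℕ) : SigmaFinite (matrixLebesgue n) :=
  inferInstanceAs (SigmaFinite (volume : Measure (Fin n → Fin n → ℂ)))

/-- The product of the Lebesgue measures of the entries. -/
def borderMeasure (n : ℕ) : Measure (BorderCoord n) :=
  (volume : Measure (Fin n → ℂ)).prod ((matrixLebesgue n).prod volume)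

instance (n : ℕ) : SigmaFinite (borderMeasure n) := by
  unfold borderMeasure; infer_instance

/-- Matrices as bordered matrices. -/
def borderEquiv (n : ℕ) :
    Matrix (Fin (n + 1)) (Fin (n + 1)) ℂ ≃ᵐ BorderCoord n × (Fin n → ℂ) where
  toFun M := ((fun j => M 0 j.succ, M.submatrix Fin.succ Fin.succ, M 0 0), fun i => M i.succ 0)
  invFun p := borderedMatrix p.1.2.2 p.1.1 p.2 p.1.2.1
  left_inv M := (eq_borderedMatrix M).symm
  right_inv _ := rfl
  measurable_toFun := by
    refine Measurable.prodMk (Measurable.prodMk ?_ (Measurable.prodMk ?_ ?_)) ?_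
    · exact measurable_pi_iff.2 fun j => Measurable.matrix_apply measurable_id _ _
    · exact measurable_matrix_iff.2 fun i j => Measurable.matrix_apply measurable_id _ _
    · exact Measurable.matrix_apply measurable_id _ _
    · exact measurable_pi_iff.2 fun j => Measurable.matrix_apply measurable_id _ _
  measurable_invFun := by
    change Measurable fun p : BorderCoord n × (Fin n → ℂ) =>
      borderedMatrix p.1.2.2 p.1.1 p.2 p.1.2.1
    fun_prop

theorem measurePreserving_borderEquiv (n : ℕ) :
    MeasurePreserving (borderEquiv n) (matrixLebesgue (n + 1)) ((borderMeasure n).prod volume) := by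
  -- The top row is peeled off (`h1`), then the first entry of every row (`h2`, `h3`, `h4`); `h6`
  -- only reorders factors.
  have h1 : MeasurePreserving
    (MeasurableEquiv.piFinSuccAbove (fun _ : Fin (n + 1) => Fin (n + 1) → ℂ) 0)
    volume volume := volume_preserving_piFinSuccAbove _ _
  have h2 : MeasurePreserving (MeasurableEquiv.piFinSuccAbove (fun _ : Fin (n + 1) => ℂ) 0)
    volume volume := volume_preserving_piFinSuccAbove _ _
  have h3 := volume_preserving_pi (fun _ : Fin n => h2)
  have h4 := volume_measurePreserving_arrowProdEquivProdArrow ℂ (Fin n → ℂ) (Fin n)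
  have h5 := (h2.prod (h4.comp h3)).comp h1
  have h6 : MeasurePreserving
      (fun p : (ℂ × (Fin n → ℂ)) × (Fin n → Fin n → ℂ) => (p.1.2, p.2, p.1.1))
      (volume.prod volume) (borderMeasure n) :=
    ((MeasurePreserving.id volume).prod Measure.measurePreserving_swap).comp
      ((measurePreserving_prodAssoc _ _ _).comp
        (Measure.measurePreserving_swap.prod (MeasurePreserving.id volume)))
  exact ((h6.prod (MeasurePreserving.id volume)).comp ((measurePreserving_prodAssoc _ _ _).symm.comp
    ((MeasurePreserving.id volume).prod Measure.measurePreserving_swap))).comp h5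

theorem lintegral_matrix_succ {n : ℕ} {F : Matrix (Fin (n + 1)) (Fin (n + 1)) ℂ → ENNReal}
    (hF : Measurable F) :
    ∫⁻ M, F M ∂matrixLebesgue (n + 1) =
      ∫⁻ t, (∫⁻ u : Fin n → ℂ, F (borderedMatrix t.2.2 t.1 u t.2.1)) ∂borderMeasure n := by
  rw [← (measurePreserving_borderEquiv n).symm.lintegral_comp hF, lintegral_prod]
  · rfl
  · exact (hF.comp (borderEquiv n).symm.measurable).aemeasurable

/-! ### Eigenvectors with first coordinate one -/

/-- The eigenvalue of the bordered matrix for the eigenvector `(1, y)`. -/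
def borderEigenvalue {n : ℕ} (t : BorderCoord n) (y : Fin n → ℂ) : ℂ := t.2.2 + t.1 ⬝ᵥ y

/-- The matrix that remains when the eigenvector `(1, y)` is split off. -/
def borderResidual {n : ℕ} (t : BorderCoord n) (y : Fin n → ℂ) : Matrix (Fin n) (Fin n) ℂ :=
  t.2.1 - vecMulVec y t.1

/-- The first column for which the bordered matrix has the eigenvector `(1, y)`. -/
def borderColumn {n : ℕ} (t : BorderCoord n) (y : Fin n → ℂ) : Fin n → ℂ :=
  borderEigenvalue t y • y - t.2.1 *ᵥ y

/-- The bordered matrix with first column `u`. -/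
def borderFill {n : ℕ} (t : BorderCoord n) (u : Fin n → ℂ) :
    Matrix (Fin (n + 1)) (Fin (n + 1)) ℂ :=
  borderedMatrix t.2.2 t.1 u t.2.1

theorem borderFill_borderColumn {n : ℕ} (t : BorderCoord n) (y : Fin n → ℂ) :
    borderFill t (borderColumn t y) =
      shear y * borderedMatrix (borderEigenvalue t y) t.1 0 (borderResidual t y) * shear (-y) := by
  rw [shear_conj, borderFill, borderColumn, borderEigenvalue, borderResidual]
  simp [add_smul]

/-- The top row of the eigenvector equation determines the eigenvalue and the other rows the first
column. Thus a fibre of `borderColumn t` is a set of normalised eigenvectors. -/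
theorem borderFill_mulVec_iff {n : ℕ} (t : BorderCoord n) (u y : Fin n → ℂ) (z : ℂ) :
    borderFill t u *ᵥ Fin.cons 1 y = z • (Fin.cons 1 y : Fin (n + 1) → ℂ) ↔
      borderEigenvalue t y = z ∧ borderColumn t y = u := by
  have h : z • (Fin.cons 1 y : Fin (n + 1) → ℂ) = Fin.cons z (z • y) := by
    funext i; refine Fin.cases ?_ (fun i => ?_) i <;> simp
  rw [borderFill, borderedMatrix_mulVec, h, Fin.cons_inj, borderColumn, borderEigenvalue, mul_one,
    one_smul]
  refine and_congr_right fun h => ?_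
  rw [h, sub_eq_iff_eq_add, eq_comm]

theorem eigenvalueTuple_spec {n : ℕ} (A : Matrix (Fin n) (Fin n) ℂ) :
    (Finset.univ : Finset (Fin n)).val.map (eigenvalueTuple A) = A.charpoly.roots :=
  (exists_eigenvalue_tuple A).choose_spec

theorem det_scalar_sub_eq_zero_iff {n : ℕ} (A : Matrix (Fin n) (Fin n) ℂ) (z : ℂ) :
    (scalar (Fin n) z - A).det = 0 ↔ ∃ i, eigenvalueTuple A i = z := by
  rw [(charpoly_roots_eq_iff A _).1 (eigenvalueTuple_spec A), Finset.prod_eq_zero_iff]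
  simp [sub_eq_zero, eq_comm]

/-- Conjugation does not change the multiset of eigenvalues. -/
theorem univ_map_eigenvalueTuple_conj {n : ℕ} {S T : Matrix (Fin n) (Fin n) ℂ} (h : S * T = 1)
    (A : Matrix (Fin n) (Fin n) ℂ) :
    (Finset.univ : Finset (Fin n)).val.map (eigenvalueTuple (S * A * T)) =
      (Finset.univ : Finset (Fin n)).val.map (eigenvalueTuple A) := by
  rw [eigenvalueTuple_spec, eq_comm, charpoly_roots_eq_iff]
  intro z
  rw [det_conj_eq h, (charpoly_roots_eq_iff A _).1 (eigenvalueTuple_spec A)]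

theorem univ_map_eigenvalueTuple_borderFill {n : ℕ} (t : BorderCoord n) (y : Fin n → ℂ) :
    (Finset.univ : Finset (Fin (n + 1))).val.map
      (eigenvalueTuple (borderFill t (borderColumn t y))) =
      borderEigenvalue t y ::ₘ
        (Finset.univ : Finset (Fin n)).val.map (eigenvalueTuple (borderResidual t y)) := by
  have : borderEigenvalue t y ::ₘ
        (Finset.univ : Finset (Fin n)).val.map (eigenvalueTuple (borderResidual t y)) =
      (Finset.univ : Finset (Fin (n + 1))).val.map
        (Fin.cons (borderEigenvalue t y) (eigenvalueTuple (borderResidual t y))) := by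
    rw [Fin.univ_val_map, Fin.univ_val_map, List.ofFn_succ]
    rfl
  rw [this, eigenvalueTuple_spec, eq_comm, charpoly_roots_eq_iff]
  intro z
  rw [borderFill_borderColumn, det_conj_eq (shear_mul_shear_neg y), det_scalar_sub_borderedMatrix,
    Fin.prod_univ_succ, (charpoly_roots_eq_iff _ _).1 (eigenvalueTuple_spec (borderResidual t y))]
  simp

theorem univ_map_succAbove {n : ℕ} {α : Type*} (e : Fin (n + 1) → α) (i : Fin (n + 1)) :
    (Finset.univ : Finset (Fin (n + 1))).val.map e =
      e i ::ₘ (Finset.univ : Finset (Fin n)).val.map fun j => e (i.succAbove j) := by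
  rw [Fin.univ_succAbove n i, Finset.cons_val, Multiset.map_cons, Finset.map_val, Multiset.map_map]
  rfl

/-- No eigenvector of `B` is annihilated by `w`. -/
def IsObservable {n : ℕ} (w : Fin n → ℂ) (B : Matrix (Fin n) (Fin n) ℂ) : Prop :=
  ∀ (x : Fin n → ℂ) (z : ℂ), x ≠ 0 → B *ᵥ x = z • x → w ⬝ᵥ x ≠ 0

/-- If the first entry vanished, the remaining entries would form an eigenvector of the lower block
annihilated by the top row. -/
theorem IsObservable.ne_zero {n : ℕ} {t : BorderCoord n} (ht : IsObservable t.1 t.2.1)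
    {u : Fin n → ℂ} {x : Fin (n + 1) → ℂ} {z : ℂ} (hx : x ≠ 0)
    (h : borderFill t u *ᵥ x = z • x) : x 0 ≠ 0 := by
  intro h0
  obtain ⟨x, rfl⟩ : ∃ x', x = Fin.cons 0 x' := ⟨Fin.tail x, by rw [← h0, Fin.cons_self_tail]⟩
  have hz : z • (Fin.cons 0 x : Fin (n + 1) → ℂ) = Fin.cons 0 (z • x) := by
    funext i; refine Fin.cases ?_ (fun i => ?_) i <;> simp
  rw [borderFill, borderedMatrix_mulVec, hz, Fin.cons_inj] at h
  refine ht x z ?_ (by simpa using h.2) (by simpa using h.1)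
  rintro rfl
  exact hx (by funext i; refine Fin.cases ?_ (fun i => ?_) i <;> simp)

theorem IsObservable.exists_borderEigenvalue_eq {n : ℕ} {t : BorderCoord n}
    (ht : IsObservable t.1 t.2.1) (u : Fin n → ℂ) (i : Fin (n + 1)) :
    ∃ y, borderEigenvalue t y = eigenvalueTuple (borderFill t u) i ∧ borderColumn t y = u := by
  obtain ⟨x, hx, hMx⟩ := exists_mulVec_eq_zero_iff.2
    ((det_scalar_sub_eq_zero_iff (borderFill t u) _).2 ⟨i, rfl⟩)
  set z := eigenvalueTuple (borderFill t u) i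
  have hMx' : borderFill t u *ᵥ x = z • x := by
    rw [sub_mulVec, sub_eq_zero] at hMx
    rw [← hMx]
    simp [scalar_apply, ← smul_one_eq_diagonal, smul_mulVec]
  have h0 := ht.ne_zero hx hMx'
  refine ⟨fun j => (x 0)⁻¹ * x j.succ, (borderFill_mulVec_iff _ _ _ _).1 ?_⟩
  have : (Fin.cons 1 fun j => (x 0)⁻¹ * x j.succ : Fin (n + 1) → ℂ) = (x 0)⁻¹ • x := by
    funext i; refine Fin.cases ?_ (fun i => ?_) i <;> simp [h0]
  rw [this, mulVec_smul, hMx', smul_comm]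

/-- Otherwise (1, y) - (1, y') would be an eigenvector with first entry zero. -/
theorem IsObservable.injective {n : ℕ} {t : BorderCoord n} (ht : IsObservable t.1 t.2.1)
    {y y' : Fin n → ℂ} (hz : borderEigenvalue t y = borderEigenvalue t y')
    (hu : borderColumn t y = borderColumn t y') : y = y' := by
  by_contra hne
  have h1 := (borderFill_mulVec_iff t _ y _).2 ⟨rfl, rfl⟩
  have h2 := (borderFill_mulVec_iff t _ y' _).2 ⟨hz.symm, hu.symm⟩
  refine ht.ne_zero (u := borderColumn t y) (z := borderEigenvalue t y)
    (x := Fin.cons 1 y - Fin.cons 1 y') (fun h => hne ?_) ?_ (by simp)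
  · rw [sub_eq_zero, Fin.cons_inj] at h
    exact h.2
  · rw [mulVec_sub, h1, h2, smul_sub]

/-- Over a regular value, the eigenvectors `(1, y)` enumerate the eigenvalues. -/
theorem tsum_fiber_borderColumn {n k : ℕ} {t : BorderCoord n} (ht : IsObservable t.1 t.2.1)
    {u : Fin n → ℂ} (hu : ∀ y, borderColumn t y = u →
      (scalar (Fin n) (borderEigenvalue t y) - borderResidual t y).det ≠ 0)
    (F : (Fin (k + 1) → ℂ) → ENNReal) :
    ∑' y : borderColumn t ⁻¹' {u}, tupleSum k (fun z => F (Fin.cons (borderEigenvalue t y) z))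
        (eigenvalueTuple (borderResidual t y)) =
      tupleSum (k + 1) F (eigenvalueTuple (borderFill t u)) := by
  choose y hyz hyu using ht.exists_borderEigenvalue_eq u
  have hm : ∀ i, (Finset.univ : Finset (Fin n)).val.map (eigenvalueTuple (borderResidual t (y i))) =
      (Finset.univ : Finset (Fin n)).val.map
        fun j => eigenvalueTuple (borderFill t u) (i.succAbove j) := fun i => by
    have h1 := univ_map_eigenvalueTuple_borderFill t (y i)
    rw [hyu, univ_map_succAbove _ i, hyz] at h1
    exact ((Multiset.cons_inj_right _).1 h1).symm
  -- A repeated eigenvalue would survive as an eigenvalue of the residual block, where the Jacobian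
  -- would then vanish; regularity of `u` excludes this.
  have hinj : Function.Injective (eigenvalueTuple (borderFill t u)) := by
    intro i j hij
    by_contra hne
    obtain ⟨l, rfl⟩ := Fin.exists_succAbove_eq (Ne.symm hne)
    refine hu (y i) (hyu i) ((det_scalar_sub_eq_zero_iff _ _).2 ?_)
    have : eigenvalueTuple (borderFill t u) (i.succAbove l) ∈ (Finset.univ : Finset (Fin n)).val.map
        (eigenvalueTuple (borderResidual t (y i))) := by
      rw [hm]
      exact Multiset.mem_map_of_mem _ (Finset.mem_univ_val l)
    obtain ⟨l', -, hl'⟩ := Multiset.mem_map.1 this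
    exact ⟨l', by rw [hl', hyz, hij]⟩
  let Y : Fin (n + 1) → borderColumn t ⁻¹' {u} := fun i => ⟨y i, hyu i⟩
  have hY : Function.Bijective Y := by
    constructor
    · intro i j hij
      refine hinj ?_
      rw [← hyz, ← hyz, show y i = y j from congrArg Subtype.val hij]
    · rintro ⟨x, hx⟩
      have hx' : borderColumn t x = u := hx
      have : borderEigenvalue t x ∈ (Finset.univ : Finset (Fin (n + 1))).val.map
          (eigenvalueTuple (borderFill t u)) := by
        rw [← hx', univ_map_eigenvalueTuple_borderFill]
        exact Multiset.mem_cons_self _ _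
      obtain ⟨i, -, hi⟩ := Multiset.mem_map.1 this
      exact ⟨i, Subtype.ext (ht.injective (by rw [hyz, hi]) (by rw [hyu, hx']))⟩
  rw [tupleSum_succ, ← (Equiv.ofBijective Y hY).tsum_eq, tsum_fintype]
  refine Finset.sum_congr rfl fun i _ => ?_
  rw [← tupleSum_congr _ (hm i), ← hyz i]
  rfl

/-! ### The derivative of the column map -/

/-- The product rule gives x ↦ z x + (w·x) y - B x, and the rank one term (w·x) y is exactly what
turns B into the residual B - y wᵀ. -/
theorem hasStrictFDerivAt_borderColumn {n : ℕ} (t : BorderCoord n) (y : Fin n → ℂ) :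
    HasStrictFDerivAt (borderColumn t)
      (((toLin' (scalar (Fin n) (borderEigenvalue t y) - borderResidual t y)).toContinuousLinearMap
        ).restrictScalars ℝ) y := by
  let ℓ : (Fin n → ℂ) →L[ℂ] ℂ := (dotProductBilin ℂ ℂ t.1).toContinuousLinearMap
  let β : (Fin n → ℂ) →L[ℂ] (Fin n → ℂ) := (toLin' t.2.1).toContinuousLinearMap
  have h1 : HasStrictFDerivAt (fun y => (t.2.2 + ℓ y) • y - β y)
    ((t.2.2 + ℓ y) • ContinuousLinearMap.id ℂ (Fin n → ℂ) + ℓ.smulRight y - β) y :=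
    ((ℓ.hasStrictFDerivAt.const_add t.2.2).smul (hasStrictFDerivAt_id y)).sub β.hasStrictFDerivAt
  have h2 : (t.2.2 + ℓ y) • ContinuousLinearMap.id ℂ (Fin n → ℂ) + ℓ.smulRight y - β =
      (toLin' (scalar (Fin n) (borderEigenvalue t y) - borderResidual t y)).toContinuousLinearMap
      := by
    ext1 x
    have h3 : vecMulVec y t.1 *ᵥ x = (t.1 ⬝ᵥ x) • y := by
      rw [vecMulVec_mulVec]; simp
    simp [ℓ, β, borderResidual, h3, borderEigenvalue]
    abel
  rw [← h2]
  exact h1.restrictScalars ℝ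

theorem det_restrictScalars_toLin' {n : ℕ} (A : Matrix (Fin n) (Fin n) ℂ) :
    ((toLin' A).toContinuousLinearMap.restrictScalars ℝ).det = ‖A.det‖ ^ 2 := by
  rw [← LinearMap.det_toLin', ← det_restrictScalars_complex]
  rfl

theorem measurable_borderEigenvalue {n : ℕ} :
    Measurable fun p : BorderCoord n × (Fin n → ℂ) => borderEigenvalue p.1 p.2 := by
  unfold borderEigenvalue dotProduct
  fun_prop

theorem measurable_borderResidual {n : ℕ} :
    Measurable fun p : BorderCoord n × (Fin n → ℂ) => borderResidual p.1 p.2 := by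
  have h : Measurable fun p : BorderCoord n × (Fin n → ℂ) => p.1.2.1 := by fun_prop
  refine measurable_matrix_iff.2 fun i j => (h.matrix_apply i j).sub ?_
  simp only [vecMulVec_apply]
  fun_prop

theorem continuous_det_scalar_sub {n : ℕ} :
    Continuous fun p : ℂ × Matrix (Fin n) (Fin n) ℂ => (scalar (Fin n) p.1 - p.2).det := by
  simp only [scalar_apply]
  exact (Continuous.sub (Continuous.matrix_diagonal (continuous_pi fun _ => continuous_fst))
    continuous_snd).matrix_det

/-- The squared modulus of the characteristic polynomial. -/
def charpolyNormSq {n : ℕ} (z : ℂ) (A : Matrix (Fin n) (Fin n) ℂ) : ENNReal :=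
  ENNReal.ofReal (‖(scalar (Fin n) z - A).det‖ ^ 2)

@[fun_prop]
theorem Measurable.charpolyNormSq {n : ℕ} {X : Type*} [MeasurableSpace X] {z : X → ℂ}
    {A : X → Matrix (Fin n) (Fin n) ℂ} (hz : Measurable z) (hA : Measurable A) :
    Measurable fun x => _root_.charpolyNormSq (z x) (A x) :=
  ((continuous_det_scalar_sub.measurable.comp (hz.prodMk hA)).norm.pow_const 2).ennreal_ofReal

/-- The area formula for the column map. -/
theorem lintegral_charpolyNormSq_mul {n : ℕ} (t : BorderCoord n) {h : (Fin n → ℂ) → ENNReal}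
    (hh : Measurable h) :
    ∫⁻ y, charpolyNormSq (borderEigenvalue t y) (borderResidual t y) * h y =
      ∫⁻ u, ∑' y : borderColumn t ⁻¹' {u}, h y := by
  have hd : Measurable fun y =>
      ‖(scalar (Fin n) (borderEigenvalue t y) - borderResidual t y).det‖ ^ 2 := by
    have h1 := measurable_borderEigenvalue.comp (measurable_prodMk_left (x := t))
    have h2 := measurable_borderResidual.comp (measurable_prodMk_left (x := t))
    exact (continuous_det_scalar_sub.measurable.comp (h1.prodMk h2)).norm.pow_const 2
  rw [← lintegral_det_mul_eq_lintegral_tsum_fiber volume (hasStrictFDerivAt_borderColumn t) _ hh]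
  · refine lintegral_congr fun y => ?_
    rw [det_restrictScalars_toLin', charpolyNormSq, abs_of_nonneg (sq_nonneg _)]
  · simpa only [det_restrictScalars_toLin'] using hd

theorem ae_det_scalar_sub_borderResidual_ne_zero {n : ℕ} (t : BorderCoord n) :
    ∀ᵐ u, ∀ y, borderColumn t y = u →
      (scalar (Fin n) (borderEigenvalue t y) - borderResidual t y).det ≠ 0 := by
  filter_upwards [ae_det_ne_zero_of_eq volume
    fun y => (hasStrictFDerivAt_borderColumn t y).hasFDerivAt] with u hu y hy h0
  exact hu y hy (by rw [det_restrictScalars_toLin', h0]; simp)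

/-! ### Generic matrices are observable -/

/-- All eigenspaces have dimension at most one. -/
def HasSimpleEigenspaces {n : ℕ} (A : Matrix (Fin n) (Fin n) ℂ) : Prop :=
  ∀ (x x' : Fin n → ℂ) (z : ℂ), x ≠ 0 → A *ᵥ x = z • x → A *ᵥ x' = z • x' → ∃ c : ℂ, x' = c • x

/-- Two independent eigenvectors for the same eigenvalue would have a nonzero combination with first
entry zero. -/
theorem IsObservable.hasSimpleEigenspaces {n : ℕ} {t : BorderCoord n}
    (ht : IsObservable t.1 t.2.1) (u : Fin n → ℂ) : HasSimpleEigenspaces (borderFill t u) := by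
  intro x x' z hx h h'
  have h0 := ht.ne_zero hx h
  refine ⟨x' 0 / x 0, ?_⟩
  by_contra hne
  refine ht.ne_zero (u := u) (z := z) (x := x' - (x' 0 / x 0) • x) (sub_ne_zero.2 hne) ?_ ?_
  · rw [mulVec_sub, mulVec_smul, h, h', smul_sub, smul_comm]
  · simp [h0]

open scoped ComplexOrder in
theorem star_dotProduct_self_ne_zero {n : ℕ} {x : Fin n → ℂ} (hx : x ≠ 0) : star x ⬝ᵥ x ≠ 0 :=
  fun h => hx (dotProduct_star_self_eq_zero.1 h)

/-- The failure set is the projection, along the compact unit sphere, of a closed set. The unknown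
eigenvalue is eliminated through the Rayleigh quotient with denominators cleared. Closedness
supplies the measurability that Fubini needs. -/
theorem isClosed_not_isObservable (n : ℕ) :
    IsClosed {p : (Fin n → ℂ) × Matrix (Fin n) (Fin n) ℂ | ¬ IsObservable p.1 p.2} := by
  let S : Set (Metric.sphere (0 : Fin n → ℂ) 1 × ((Fin n → ℂ) × Matrix (Fin n) (Fin n) ℂ)) :=
    {q | (star q.1.1 ⬝ᵥ q.1.1) • (q.2.2 *ᵥ q.1.1) = (star q.1.1 ⬝ᵥ (q.2.2 *ᵥ q.1.1)) • q.1.1 ∧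
      q.2.1 ⬝ᵥ q.1.1 = 0}
  have hS : IsClosed S := (isClosed_eq (by fun_prop) (by fun_prop)).inter
    (isClosed_eq (by fun_prop) (by fun_prop))
  convert isClosedMap_snd_of_compactSpace S hS using 1
  ext ⟨w, B⟩
  constructor
  · intro h
    simp only [IsObservable, Set.mem_ofPred_eq, not_forall, ne_eq, not_not] at h
    obtain ⟨x, z, hx, hB, hw⟩ := h
    have hn : ‖x‖ ≠ 0 := norm_ne_zero_iff.2 hx
    refine ⟨(⟨((‖x‖ : ℂ)⁻¹) • x, by simp [norm_smul, hn]⟩, (w, B)), ⟨?_, ?_⟩, rfl⟩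
    · simp only [mulVec_smul, hB, dotProduct_smul, smul_smul, smul_eq_mul]
      congr 1; ring
    · simp [dotProduct_smul, hw]
  · rintro ⟨⟨x, w', B'⟩, ⟨h1, h2⟩, heq⟩
    obtain ⟨rfl, rfl⟩ : w' = w ∧ B' = B := by simpa using heq
    have hx : x.1 ≠ 0 := ne_zero_of_mem_unit_sphere x
    have hd : star x.1 ⬝ᵥ x.1 ≠ 0 := star_dotProduct_self_ne_zero hx
    intro hobs
    refine hobs x.1 ((star x.1 ⬝ᵥ x.1)⁻¹ * (star x.1 ⬝ᵥ (B' *ᵥ x.1))) hx ?_ h2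
    rw [mul_smul]
    dsimp only at h1
    rw [← h1, smul_smul, inv_mul_cancel₀ hd, one_smul]

/-- There are finitely many eigenlines, and each excludes only a proper subspace of vectors w. -/
theorem ae_isObservable_of_hasSimpleEigenspaces {n : ℕ} {B : Matrix (Fin n) (Fin n) ℂ}
    (hB : HasSimpleEigenspaces B) : ∀ᵐ w : Fin n → ℂ, IsObservable w B := by
  have h1 : ∀ i, ∀ᵐ w : Fin n → ℂ, ∀ x, x ≠ 0 → B *ᵥ x = eigenvalueTuple B i • x →
      w ⬝ᵥ x ≠ 0 := by
    intro i
    by_cases hx : ∃ x, x ≠ 0 ∧ B *ᵥ x = eigenvalueTuple B i • x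
    · obtain ⟨x, hx, hBx⟩ := hx
      let ℓ : (Fin n → ℂ) →ₗ[ℝ] ℂ := (dotProductBilin ℂ ℂ x).restrictScalars ℝ
      have hne : LinearMap.ker ℓ ≠ ⊤ := by
        intro h
        have : star x ∈ LinearMap.ker ℓ := h ▸ Submodule.mem_top
        exact star_dotProduct_self_ne_zero hx (by rwa [dotProduct_comm])
      have := Measure.addHaar_submodule (volume : Measure (Fin n → ℂ)) (LinearMap.ker ℓ) hne
      rw [measure_eq_zero_iff_ae_notMem] at this
      filter_upwards [this] with w hw x' hx' hBx' h0
      obtain ⟨c, rfl⟩ := hB x x' _ hx hBx hBx'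
      have hc : c ≠ 0 := by rintro rfl; simp at hx'
      refine hw ?_
      rw [dotProduct_smul, smul_eq_mul, mul_eq_zero, or_iff_right hc, dotProduct_comm] at h0
      exact h0
    · exact Filter.Eventually.of_forall fun w x hx0 h => absurd ⟨x, hx0, h⟩ hx
  filter_upwards [ae_all_iff.2 h1] with w hw x z hx hBx
  have : (scalar (Fin n) z - B).det = 0 := by
    refine exists_mulVec_eq_zero_iff.1 ⟨x, hx, ?_⟩
    rw [sub_mulVec, hBx, sub_eq_zero]
    simp [scalar_apply, ← smul_one_eq_diagonal, smul_mulVec]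
  obtain ⟨i, rfl⟩ := (det_scalar_sub_eq_zero_iff B z).1 this
  exact hw i x hx hBx

theorem ae_isObservable_of_ae {n : ℕ}
    (h : ∀ᵐ B ∂matrixLebesgue n, HasSimpleEigenspaces B) :
    ∀ᵐ t ∂borderMeasure n, IsObservable t.1 t.2.1 := by
  have h1 : ∀ᵐ p : (Fin n → ℂ) × Matrix (Fin n) (Fin n) ℂ
      ∂(volume : Measure (Fin n → ℂ)).prod (matrixLebesgue n), IsObservable p.1 p.2 := by
    have hm : MeasurableSet
        {p : (Fin n → ℂ) × Matrix (Fin n) (Fin n) ℂ | IsObservable p.1 p.2} := by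
      simpa only [Set.compl_ofPred, not_not] using (isClosed_not_isObservable n).measurableSet.compl
    rw [Measure.ae_prod_iff_ae_ae hm, Measure.ae_ae_comm hm]
    exact h.mono fun B hB => ae_isObservable_of_hasSimpleEigenspaces hB
  have h2 : MeasurePreserving (MeasurableEquiv.prodAssoc.symm :
      (Fin n → ℂ) × Matrix (Fin n) (Fin n) ℂ × ℂ ≃ᵐ _) (borderMeasure n)
      (((volume : Measure (Fin n → ℂ)).prod (matrixLebesgue n)).prod volume) :=
    (measurePreserving_prodAssoc _ _ _).symm
  exact h2.quasiMeasurePreserving.ae (Measure.quasiMeasurePreserving_fst.ae h1)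

/-- Induction by bordering: simple eigenspaces of B make almost every w observable, and then every
corner and first column yield a larger matrix with simple eigenspaces. -/
theorem ae_hasSimpleEigenspaces (n : ℕ) : ∀ᵐ A ∂matrixLebesgue n, HasSimpleEigenspaces A := by
  induction n with
  | zero => exact Filter.Eventually.of_forall fun A x x' z hx => absurd (Subsingleton.elim _ _) hx
  | succ n ih =>
    have h1 : ∀ᵐ p ∂(borderMeasure n).prod (volume : Measure (Fin n → ℂ)),
        HasSimpleEigenspaces (borderFill p.1 p.2) :=
      (Measure.quasiMeasurePreserving_fst.ae (ae_isObservable_of_ae ih)).mono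
        fun p hp => hp.hasSimpleEigenspaces p.2
    filter_upwards [(measurePreserving_borderEquiv n).quasiMeasurePreserving.ae h1] with M hM
    have := (borderEquiv n).symm_apply_apply M
    exact this ▸ hM

theorem ae_isObservable (n : ℕ) : ∀ᵐ t ∂borderMeasure n, IsObservable t.1 t.2.1 :=
  ae_isObservable_of_ae (ae_hasSimpleEigenspaces n)

/-! ### Splitting off one eigenvector, in affine coordinates -/

/-- A pair of matrices `S`, `T` and the entries of `(z, w; 0, A)`. -/
abbrev DeflationData (n : ℕ) : Type :=
  (Matrix (Fin (n + 1)) (Fin (n + 1)) ℂ × Matrix (Fin (n + 1)) (Fin (n + 1)) ℂ) × BorderCoord n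

/-- The matrix `S (z, w; 0, A) T`. -/
def inflate {n : ℕ} (p : DeflationData n) : Matrix (Fin (n + 1)) (Fin (n + 1)) ℂ :=
  p.1.1 * borderedMatrix p.2.2.2 p.2.1 0 p.2.2.1 * p.1.2

/-- The sum over the tuples that start with `z` and continue with eigenvalues of `A`, for the matrix
`S (z, w; 0, A) T`. -/
def deflatedTupleSum {n k : ℕ}
    (F : (Fin (k + 1) → ℂ) → Matrix (Fin (n + 1)) (Fin (n + 1)) ℂ → ENNReal)
    (p : DeflationData n) : ENNReal :=
  tupleSum k (fun z => F (Fin.cons p.2.2.2 z) (inflate p)) (eigenvalueTuple p.2.2.1)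

theorem measurable_inflate {n : ℕ} : Measurable (inflate (n := n)) := by
  unfold inflate
  fun_prop

@[fun_prop]
theorem Measurable.fin_cons {k : ℕ} {X : Type*} [MeasurableSpace X] {a : X → ℂ}
    {z : X → Fin k → ℂ} (ha : Measurable a) (hz : Measurable z) :
    Measurable fun x => (Fin.cons (a x) (z x) : Fin (k + 1) → ℂ) := by
  refine measurable_pi_iff.2 fun i => Fin.cases ?_ (fun i => ?_) i
  · simpa only [Fin.cons_zero]
  · simp only [Fin.cons_succ]; fun_prop

theorem measurable_deflatedTupleSum {n k : ℕ}
    {F : (Fin (k + 1) → ℂ) → Matrix (Fin (n + 1)) (Fin (n + 1)) ℂ → ENNReal}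
    (hF : Measurable (Function.uncurry F)) : Measurable (deflatedTupleSum F) := by
  have h1 : Measurable fun q : DeflationData n × (Fin k → ℂ) =>
      ((Fin.cons q.1.2.2.2 q.2 : Fin (k + 1) → ℂ), inflate q.1) :=
    Measurable.prodMk (by fun_prop) (measurable_inflate.comp measurable_fst)
  exact Measurable.tupleSum_eigenvalueTuple
    (F := fun (p : DeflationData n) z => F (Fin.cons p.2.2.2 z) (inflate p)) (hF.comp h1)
    (by fun_prop)

/-- The integrand that arises when one eigenvector is split off. -/
def deflatedIntegrand {n k : ℕ}
    (F : (Fin (k + 1) → ℂ) → Matrix (Fin (n + 1)) (Fin (n + 1)) ℂ → ENNReal)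
    (p : DeflationData n) : ENNReal :=
  charpolyNormSq p.2.2.2 p.2.2.1 * deflatedTupleSum F p

theorem measurable_deflatedIntegrand {n k : ℕ}
    {F : (Fin (k + 1) → ℂ) → Matrix (Fin (n + 1)) (Fin (n + 1)) ℂ → ENNReal}
    (hF : Measurable (Function.uncurry F)) : Measurable (deflatedIntegrand F) :=
  Measurable.mul (by fun_prop) (measurable_deflatedTupleSum hF)

/-- For fixed y, the entries B and a are translated by amounts that depend only on the untouched w.
-/
theorem measurePreserving_borderResidual {n : ℕ} (y : Fin n → ℂ) :
    MeasurePreserving (fun t : BorderCoord n => (t.1, borderResidual t y, borderEigenvalue t y))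
      (borderMeasure n) (borderMeasure n) := by
  have h1 : Measurable fun t : BorderCoord n => (borderResidual t y, borderEigenvalue t y) :=
    (measurable_borderResidual.comp measurable_prodMk_right).prodMk
      (measurable_borderEigenvalue.comp measurable_prodMk_right)
  refine (MeasurePreserving.id _).skew_product
    (g := fun w p => (borderResidual (w, p) y, borderEigenvalue (w, p) y)) h1
    (Filter.Eventually.of_forall fun w => ?_)
  have h2 : MeasurePreserving (fun B : Matrix (Fin n) (Fin n) ℂ => B - vecMulVec y w)
      (matrixLebesgue n) (matrixLebesgue n) := by
    simp only [sub_eq_neg_add]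
    exact measurePreserving_add_left (volume : Measure (Fin n → Fin n → ℂ)) (-vecMulVec y w)
  have h3 : MeasurePreserving (fun a : ℂ => a + w ⬝ᵥ y) volume volume :=
    measurePreserving_add_right volume _
  exact (h2.prod h3).map_eq

/-- For fixed t the area formula trades the column u for the affine eigenvector y. Tonelli then puts
y outside, where t can be replaced by the deflated coordinates. -/
theorem lintegral_tupleSum_eigenvalueTuple {n k : ℕ}
    {F : (Fin (k + 1) → ℂ) → Matrix (Fin (n + 1)) (Fin (n + 1)) ℂ → ENNReal}
    (hF : Measurable (Function.uncurry F)) :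
    ∫⁻ M, tupleSum (k + 1) (fun z => F z M) (eigenvalueTuple M) ∂matrixLebesgue (n + 1) =
      ∫⁻ y : Fin n → ℂ,
        (∫⁻ t, deflatedIntegrand F ((shear y, shear (-y)), t) ∂borderMeasure n) := by
  have hm : Measurable fun M : Matrix (Fin (n + 1)) (Fin (n + 1)) ℂ =>
      tupleSum (k + 1) (fun z => F z M) (eigenvalueTuple M) :=
    Measurable.tupleSum_eigenvalueTuple (F := fun M z => F z M)
      (hF.comp measurable_swap) measurable_id
  have h3 : Measurable fun p : BorderCoord n × (Fin n → ℂ) =>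
      (((shear p.2, shear (-p.2)), (p.1.1, borderResidual p.1 p.2, borderEigenvalue p.1 p.2)) :
        DeflationData n) := by
    have h1 := measurable_borderResidual (n := n)
    have h2 := measurable_borderEigenvalue (n := n)
    fun_prop
  rw [lintegral_matrix_succ hm]
  calc _ = ∫⁻ t, (∫⁻ y : Fin n → ℂ, deflatedIntegrand F ((shear y, shear (-y)),
        (t.1, borderResidual t y, borderEigenvalue t y))) ∂borderMeasure n := by
        refine lintegral_congr_ae ?_
        filter_upwards [ae_isObservable n] with t ht
        let h : (Fin n → ℂ) → ENNReal := fun y => deflatedTupleSum F ((shear y, shear (-y)),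
          (t.1, borderResidual t y, borderEigenvalue t y))
        have hh : Measurable h :=
          ((measurable_deflatedTupleSum hF).comp h3).comp measurable_prodMk_left
        refine Eq.trans ?_ (lintegral_charpolyNormSq_mul t hh).symm
        refine lintegral_congr_ae ?_
        filter_upwards [ae_det_scalar_sub_borderResidual_ne_zero t] with u hu
        refine (tsum_fiber_borderColumn ht hu fun z => F z (borderFill t u)).symm.trans ?_
        refine tsum_congr fun y => ?_
        have hy : borderColumn t y = u := y.2
        simp only [h, deflatedTupleSum, inflate]
        rw [← borderFill_borderColumn, hy]
    _ = ∫⁻ y : Fin n → ℂ, (∫⁻ t, deflatedIntegrand F ((shear y, shear (-y)),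
        (t.1, borderResidual t y, borderEigenvalue t y)) ∂borderMeasure n) :=
        lintegral_lintegral_swap ((measurable_deflatedIntegrand hF).comp h3).aemeasurable
    _ = _ := by
        refine lintegral_congr fun y => ?_
        exact (measurePreserving_borderResidual y).lintegral_comp
          ((measurable_deflatedIntegrand hF).comp measurable_prodMk_left)

/-! ### Change of variables in the upper triangular blocks -/

instance isAddHaarMeasure_volume_fin_pi_pi (n : ℕ) :
    (volume : Measure (Fin n → Fin n → ℂ)).IsAddHaarMeasure where
  toIsFiniteMeasureOnCompacts := inferInstance
  toIsAddLeftInvariant := inferInstance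
  toIsOpenPosMeasure := Measure.pi.isOpenPosMeasure _

/-- Left multiplication as a linear map on arrays of entries. -/
def mulLeftLinear {n : ℕ} (S : Matrix (Fin n) (Fin n) ℂ) :
    (Fin n → Fin n → ℂ) →ₗ[ℂ] (Fin n → Fin n → ℂ) where
  toFun A := S * (Matrix.of A)
  map_add' A B := Matrix.mul_add S A B
  map_smul' c A := Matrix.mul_smul S c A

/-- Right multiplication as a linear map on arrays of entries. -/
def mulRightLinear {n : ℕ} (S : Matrix (Fin n) (Fin n) ℂ) :
    (Fin n → Fin n → ℂ) →ₗ[ℂ] (Fin n → Fin n → ℂ) where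
  toFun A := (Matrix.of A) * S
  map_add' A B := Matrix.add_mul A B S
  map_smul' c A := Matrix.smul_mul c A S

theorem det_mulRightLinear {n : ℕ} (S : Matrix (Fin n) (Fin n) ℂ) :
    LinearMap.det (mulRightLinear S) = S.det ^ n := by
  have : mulRightLinear S = LinearMap.pi fun i : Fin n =>
      (toLin' Sᵀ).comp (LinearMap.proj (φ := fun _ : Fin n => Fin n → ℂ) i) := by
    refine LinearMap.ext fun A => funext fun i => funext fun j => ?_
    exact (Matrix.mul_apply).trans (Finset.sum_congr rfl fun l _ => mul_comm (A i l) (S l j))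
  rw [this, LinearMap.det_pi]
  simp

theorem det_mulLeftLinear {n : ℕ} (S : Matrix (Fin n) (Fin n) ℂ) :
    LinearMap.det (mulLeftLinear S) = S.det ^ n := by
  let e : (Fin n → Fin n → ℂ) ≃ₗ[ℂ] (Fin n → Fin n → ℂ) := transposeLinearEquiv (Fin n) (Fin n) ℂ ℂ
  have : mulLeftLinear S = e.toLinearMap ∘ₗ mulRightLinear Sᵀ ∘ₗ e.symm.toLinearMap := by
    refine LinearMap.ext fun A => ?_
    exact (transpose_transpose (S * Matrix.of A)).symm.trans
      (congrArg transpose (transpose_mul S (Matrix.of A)))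
  rw [this, LinearMap.det_conj, det_mulRightLinear, det_transpose]

/-- The complex determinant of the conjugation is (det S · det T)ⁿ = 1. -/
theorem measurePreserving_conj {n : ℕ} {S T : Matrix (Fin n) (Fin n) ℂ} (h : S * T = 1) :
    MeasurePreserving (fun A => S * A * T) (matrixLebesgue n) (matrixLebesgue n) := by
  let f := mulRightLinear T ∘ₗ mulLeftLinear S
  have hf : LinearMap.det f = 1 := by
    rw [LinearMap.det_comp, det_mulLeftLinear, det_mulRightLinear, ← mul_pow, mul_comm, ← det_mul,
      h, det_one, one_pow]
  have hm : Measurable fun A : Matrix (Fin n) (Fin n) ℂ => S * A * T := by fun_prop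
  refine ⟨hm, Measure.ext fun s hs => ?_⟩
  have := lintegral_comp_complexLinear (volume : Measure (Fin n → Fin n → ℂ)) f (by simp [hf])
    (g := Set.indicator s 1) (measurable_one.indicator hs)
  rw [hf, norm_one, one_pow, ENNReal.ofReal_one, one_mul] at this
  rw [Measure.map_apply hm hs, ← lintegral_indicator_one hs, ← lintegral_indicator_one (hm hs)]
  exact this

theorem lintegral_comp_vecMul {n : ℕ} {S : Matrix (Fin n) (Fin n) ℂ} (hS : S.det ≠ 0)
    (b : Fin n → ℂ) {g : (Fin n → ℂ) → ENNReal} (hg : Measurable g) :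
    ENNReal.ofReal (‖S.det‖ ^ 2) * ∫⁻ w, g (w ᵥ* S + b) = ∫⁻ w, g w := by
  have h1 := lintegral_comp_complexLinear volume (toLin' Sᵀ)
    (by rwa [LinearMap.det_toLin', det_transpose]) (hg.comp (measurable_add_const b))
  rw [LinearMap.det_toLin', det_transpose] at h1
  simp only [Function.comp_apply, toLin'_apply, mulVec_transpose] at h1
  rw [h1, lintegral_add_right_eq_self]

theorem deflatedIntegrand_congr {n k : ℕ}
    (F : (Fin (k + 1) → ℂ) → Matrix (Fin (n + 1)) (Fin (n + 1)) ℂ → ENNReal)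
    {S T S' T' : Matrix (Fin (n + 1)) (Fin (n + 1)) ℂ} {w w' : Fin n → ℂ}
    {A K K' : Matrix (Fin n) (Fin n) ℂ} {z : ℂ} (hK : K * K' = 1)
    (h : inflate ((S, T), (w, A, z)) = inflate ((S', T'), (w', K * A * K', z))) :
    deflatedIntegrand F ((S, T), (w, A, z)) =
      deflatedIntegrand F ((S', T'), (w', K * A * K', z)) := by
  simp only [deflatedIntegrand, deflatedTupleSum, charpolyNormSq, det_conj_eq hK]
  rw [h, tupleSum_congr _ (univ_map_eigenvalueTuple_conj hK A)]

/-- Conjugation by a block triangular matrix changes the integral by a power of its corner. -/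
theorem lintegral_deflatedIntegrand_conj {n k : ℕ}
    {F : (Fin (k + 1) → ℂ) → Matrix (Fin (n + 1)) (Fin (n + 1)) ℂ → ENNReal}
    (hF : Measurable (Function.uncurry F)) {R L L' : Matrix (Fin (n + 1)) (Fin (n + 1)) ℂ}
    {c : ℂ} {b : Fin n → ℂ} {K : Matrix (Fin n) (Fin n) ℂ}
    (hR : R * R = 1) (hL : L' * L = 1) (hc : c ≠ 0) (hK : K.det ≠ 0)
    (hRL : R = L * borderedMatrix c b 0 K) (z : ℂ) :
    ENNReal.ofReal (‖c ^ n * K.det⁻¹‖ ^ 2) *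
      ∫⁻ w : Fin n → ℂ, (∫⁻ A, deflatedIntegrand F ((R, R), (w, A, z)) ∂matrixLebesgue n) =
    ∫⁻ w : Fin n → ℂ, (∫⁻ A, deflatedIntegrand F ((L, L'), (w, A, z)) ∂matrixLebesgue n) := by
  have hKu : IsUnit K.det := isUnit_iff_ne_zero.2 hK
  have hKK : K * K⁻¹ = 1 := mul_nonsing_inv K hKu
  have hKK' : K⁻¹ * K = 1 := nonsing_inv_mul K hKu
  -- With U = (c, b; 0, K) and X = (z, w; 0, A), one has U X = X' U for X' of the same shape. As R
  -- is an involution, U R = L', so R X R = L U X R = L X' U R = L X' L'.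
  have key : ∀ w A, inflate ((R, R), (w, A, z)) =
      inflate ((L, L'), ((c • w + b ᵥ* A - z • b) ᵥ* K⁻¹, K * A * K⁻¹, z)) := by
    intro w A
    have h1 : borderedMatrix c b 0 K * borderedMatrix z w 0 A =
        borderedMatrix z ((c • w + b ᵥ* A - z • b) ᵥ* K⁻¹) 0 (K * A * K⁻¹) *
          borderedMatrix c b 0 K := by
      rw [borderedMatrix_mul, borderedMatrix_mul]
      congr 1
      · simp [mul_comm]
      · rw [vecMul_vecMul, hKK', vecMul_one]; abel
      · simp
      · rw [mul_assoc, hKK']; simp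
    have h2 : borderedMatrix c b 0 K * R = L' := by
      rw [show borderedMatrix c b 0 K = L' * R by rw [hRL, ← mul_assoc, hL, one_mul], mul_assoc,
        hR, mul_one]
    simp only [inflate]
    rw [← h2, ← mul_assoc, mul_assoc L, ← h1, ← mul_assoc, ← hRL]
  have hint : ∀ (L L' : Matrix (Fin (n + 1)) (Fin (n + 1)) ℂ), Measurable
      fun p : (Fin n → ℂ) × Matrix (Fin n) (Fin n) ℂ =>
        deflatedIntegrand F ((L, L'), (p.1, p.2, z)) := fun L L' =>
    (measurable_deflatedIntegrand hF).comp (by fun_prop)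
  -- For fixed A the row w undergoes an affine map with linear part c K⁻¹, the only source of a
  -- Jacobian; A is merely conjugated.
  have hdet : ((c • K⁻¹).det) = c ^ n * K.det⁻¹ := by
    rw [det_smul, Fintype.card_fin, det_nonsing_inv, Ring.inverse_eq_inv']
  have hdet0 : (c • K⁻¹).det ≠ 0 := by
    rw [hdet]; exact mul_ne_zero (pow_ne_zero _ hc) (inv_ne_zero hK)
  rw [lintegral_lintegral_swap (hint R R).aemeasurable,
    ← lintegral_const_mul _ (Measurable.lintegral_prod_left' (hint R R))]
  calc _ = ∫⁻ A, (∫⁻ w : Fin n → ℂ, deflatedIntegrand F ((L, L'), (w, K * A * K⁻¹, z)))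
        ∂matrixLebesgue n := by
        refine lintegral_congr fun A => ?_
        have hg : Measurable fun w : Fin n → ℂ =>
            deflatedIntegrand F ((L, L'), (w, K * A * K⁻¹, z)) :=
          (measurable_deflatedIntegrand hF).comp (by fun_prop)
        rw [← lintegral_comp_vecMul hdet0 ((b ᵥ* A - z • b) ᵥ* K⁻¹) hg, hdet]
        congr 1
        refine lintegral_congr fun w => ?_
        refine deflatedIntegrand_congr F hKK ?_
        rw [key]
        congr 4
        rw [add_sub_assoc, add_vecMul, vecMul_smul, smul_vecMul]
    _ = ∫⁻ A, (∫⁻ w : Fin n → ℂ, deflatedIntegrand F ((L, L'), (w, A, z))) ∂matrixLebesgue n :=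
        (measurePreserving_conj hKK).lintegral_comp
          (f := fun A => ∫⁻ w : Fin n → ℂ, deflatedIntegrand F ((L, L'), (w, A, z)))
          (Measurable.lintegral_prod_left' (hint L L'))
    _ = _ := (lintegral_lintegral_swap (hint L L').aemeasurable).symm

/-! ### The Householder reflection -/

section Householder

variable {n : ℕ}

theorem star_dotProduct_eq_norm_sq (u : EuclideanSpace ℂ (Fin n)) :
    star (u : Fin n → ℂ) ⬝ᵥ (u : Fin n → ℂ) = (‖u‖ : ℂ) ^ 2 := by
  rw [dotProduct_comm, ← EuclideanSpace.inner_eq_star_dotProduct, inner_self_eq_norm_sq_to_K]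
  rfl

theorem householder_mul_self (v : EuclideanSpace ℂ (Fin (n + 1))) :
    householder v * householder v = 1 := by
  set u := phaseNormalize v - EuclideanSpace.single 0 1
  have hR : householder v = 1 - (2 / (‖u‖ : ℂ) ^ 2) • vecMulVec u (star (u : Fin (n + 1) → ℂ)) :=
    rfl
  rw [hR]
  have h := star_dotProduct_eq_norm_sq u
  -- If u = 0, division by zero returns 0 and the reflection is the identity.
  by_cases hc : (‖u‖ : ℂ) ^ 2 = 0
  · simp [hc]
  · set c := (‖u‖ : ℂ) ^ 2
    have h2 : vecMulVec (u : Fin (n + 1) → ℂ) (star u) * vecMulVec (u : Fin (n + 1) → ℂ) (star u) =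
        c • vecMulVec (u : Fin (n + 1) → ℂ) (star u) := by
      rw [Matrix.vecMulVec_mul_vecMulVec, h, vecMulVec_smul]
    rw [mul_sub, mul_one, sub_mul, one_mul, smul_mul_assoc, mul_smul_comm, h2, smul_smul, smul_smul]
    rw [show 2 / c * (2 / c) * c = 2 / c + 2 / c by field_simp; norm_num, add_smul]
    abel

theorem norm_det_householder (v : EuclideanSpace ℂ (Fin (n + 1))) : ‖(householder v).det‖ = 1 := by
  have h := congrArg (fun A => ‖A.det‖) (householder_mul_self v)
  simp only [det_mul, det_one, norm_mul, norm_one] at h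
  nlinarith [norm_nonneg (householder v).det]

theorem phaseNormalize_zero (v : EuclideanSpace ℂ (Fin (n + 1))) :
    phaseNormalize v 0 = (‖v 0‖ : ℂ) := by
  unfold phaseNormalize
  split_ifs with h
  · simp [h]
  · simp [h]

theorem norm_phaseNormalize (v : EuclideanSpace ℂ (Fin (n + 1))) : ‖phaseNormalize v‖ = ‖v‖ := by
  unfold phaseNormalize
  split_ifs with h
  · rfl
  · simp [norm_smul, h]

/-- The Householder reflection maps the first basis vector to the normalised vector. -/
theorem householder_apply_zero {v : EuclideanSpace ℂ (Fin (n + 1))} (hv : ‖v‖ = 1)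
    (i : Fin (n + 1)) : householder v i 0 = phaseNormalize v i := by
  set p := phaseNormalize v with hp
  have hp0 : p 0 = (‖v 0‖ : ℂ) := phaseNormalize_zero v
  have hpn : ‖p‖ = 1 := by rw [hp, norm_phaseNormalize, hv]
  set u : EuclideanSpace ℂ (Fin (n + 1)) := p - EuclideanSpace.single 0 1 with hu
  have hu0 : u 0 = (‖v 0‖ : ℂ) - 1 := by simp [hu, hp0]
  have hus (i : Fin n) : u i.succ = p i.succ := by simp [hu, Fin.succ_ne_zero]
  -- Expanding ‖p - e₁‖² for a unit vector p with real first entry |v₀|.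
  have hun : ‖u‖ ^ 2 = 2 * (1 - ‖v 0‖) := by
    have h1 := EuclideanSpace.norm_sq_eq p
    have h2 := EuclideanSpace.norm_sq_eq u
    rw [Fin.sum_univ_succ] at h1 h2
    simp only [hus] at h2
    rw [hp0, Complex.norm_real, norm_norm, hpn] at h1
    rw [hu0, ← Complex.ofReal_one, ← Complex.ofReal_sub, Complex.norm_real, Real.norm_eq_abs,
      sq_abs] at h2
    linarith
  have hR : householder v i 0 =
      (1 : Matrix (Fin (n + 1)) (Fin (n + 1)) ℂ) i 0 - 2 / (‖u‖ : ℂ) ^ 2 * (u i * star (u 0)) := rfl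
  have h1 : (1 : Matrix (Fin (n + 1)) (Fin (n + 1)) ℂ) i 0 + u i = p i := by
    simp [hu, Matrix.one_apply]
  have hun' : (‖u‖ : ℂ) ^ 2 = 2 * (1 - ‖v 0‖) := by exact_mod_cast hun
  have hs : star (u 0) = (‖v 0‖ : ℂ) - 1 := by rw [hu0]; simp
  rw [hR, ← h1, hs]
  by_cases ha : (1 : ℂ) - ‖v 0‖ = 0
  · have : u = 0 := by
      rw [ha, mul_zero] at hun'
      simpa using hun'
    simp [this]
  · rw [hun']
    field_simp
    ring

/-- The affine coordinates of a line. -/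
def affineCoord (x : Fin (n + 1) → ℂ) : Fin n → ℂ := fun i => x i.succ / x 0

/-- The first column of the reflection is |v₀| (1, y), so removing the shear clears everything below
the corner. The determinant relation follows since the reflection has determinant of modulus one and
the shear has determinant one. -/
theorem exists_householder_eq_shear_mul {v : EuclideanSpace ℂ (Fin (n + 1))} (hv : ‖v‖ = 1)
    (h0 : v 0 ≠ 0) : ∃ (b : Fin n → ℂ) (K : Matrix (Fin n) (Fin n) ℂ),
      householder v = shear (affineCoord v) * borderedMatrix (‖v 0‖ : ℂ) b 0 K ∧
      ‖v 0‖ * ‖K.det‖ = 1 := by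
  set y := affineCoord v
  set w : Fin n → ℂ := fun j => householder v 0 j.succ
  set B := (householder v).submatrix Fin.succ Fin.succ
  have h1 : householder v = shear y * borderedMatrix (‖v 0‖ : ℂ) w 0 (B - vecMulVec y w) := by
    rw [shear, borderedMatrix_mul, eq_borderedMatrix (householder v)]
    congr 1
    · rw [householder_apply_zero hv, phaseNormalize_zero]; simp
    · simp [w]
    · funext i
      rw [householder_apply_zero hv]
      simp [phaseNormalize, h0, y, affineCoord]
      ring
    · simp [B]
  refine ⟨w, B - vecMulVec y w, h1, ?_⟩
  have h2 : (shear y).det = 1 := by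
    rw [← det_transpose, show (shear y)ᵀ = borderedMatrix 1 y 0 1ᵀ from
      borderedMatrix_ext rfl (fun _ => rfl) (fun _ => rfl) fun _ _ => rfl, det_borderedMatrix]
    simp
  have h3 := norm_det_householder v
  rw [h1, det_mul, h2, det_borderedMatrix, one_mul, norm_mul] at h3
  simpa using h3

end Householder

/-- Passing from the Householder reflection to affine coordinates. -/
theorem lintegral_deflatedIntegrand_householder {n k : ℕ}
    {F : (Fin (k + 1) → ℂ) → Matrix (Fin (n + 1)) (Fin (n + 1)) ℂ → ENNReal}
    (hF : Measurable (Function.uncurry F)) {v : EuclideanSpace ℂ (Fin (n + 1))} (hv : ‖v‖ = 1)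
    (h0 : v 0 ≠ 0) (z : ℂ) :
    ENNReal.ofReal (‖v 0‖ ^ (2 * n + 2)) *
      ∫⁻ w : Fin n → ℂ, (∫⁻ A, deflatedIntegrand F ((householder v, householder v), (w, A, z))
        ∂matrixLebesgue n) =
    ∫⁻ w : Fin n → ℂ, (∫⁻ A, deflatedIntegrand F
      ((shear (affineCoord v), shear (-affineCoord v)), (w, A, z)) ∂matrixLebesgue n) := by
  obtain ⟨b, K, hR, hK⟩ := exists_householder_eq_shear_mul hv h0
  have hv0 : ‖v 0‖ ≠ 0 := norm_ne_zero_iff.2 h0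
  have hK0 : K.det ≠ 0 := by
    intro h
    simp [h] at hK
  rw [← lintegral_deflatedIntegrand_conj hF (householder_mul_self v) (shear_neg_mul_shear _)
    (by simpa using h0) hK0 hR]
  have hc : ‖(‖v 0‖ : ℂ) ^ n * K.det⁻¹‖ ^ 2 = ‖v 0‖ ^ (2 * n + 2) := by
    rw [norm_mul, norm_pow, norm_inv, Complex.norm_real, norm_norm,
      ← eq_inv_of_mul_eq_one_left hK]
    ring
  rw [hc]

/-! ### The Fubini–Study measure -/

theorem lintegral_ball_norm_pow (n : ℕ) :
    ∫⁻ s : ℂ, (Metric.ball 0 1).indicator (fun s => ENNReal.ofReal (‖s‖ ^ (2 * n))) s =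
      ENNReal.ofReal (2 * Real.pi / (2 * n + 2)) := by
  rw [← Complex.lintegral_comp_polarCoord_symm, polarCoord_target]
  have h1 : ∀ p ∈ Set.Ioi (0 : ℝ) ×ˢ Set.Ioo (-Real.pi) Real.pi, ENNReal.ofReal p.1 •
      (Metric.ball 0 1).indicator (fun s => ENNReal.ofReal (‖s‖ ^ (2 * n)))
        (Complex.polarCoord.symm p) =
      (Set.Iio (1 : ℝ)).indicator (fun r => ENNReal.ofReal (r ^ (2 * n + 1))) p.1 * 1 := by
    rintro ⟨r, θ⟩ ⟨hr, -⟩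
    have hr' : 0 < r := hr
    have hn : ‖Complex.polarCoord.symm (r, θ)‖ = r := by
      rw [Complex.norm_polarCoord_symm, abs_of_pos hr']
    by_cases h : r < 1
    · rw [Set.indicator_of_mem (by rwa [mem_ball_zero_iff, hn]),
        Set.indicator_of_mem (Set.mem_Iio.2 h), hn, smul_eq_mul, ← ENNReal.ofReal_mul hr'.le,
        mul_one, pow_succ']
    · rw [Set.indicator_of_notMem (by rwa [mem_ball_zero_iff, hn]),
        Set.indicator_of_notMem (by rwa [Set.mem_Iio])]
      simp
  rw [setLIntegral_congr_fun (measurableSet_Ioi.prod measurableSet_Ioo) h1, Measure.volume_eq_prod,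
    ← Measure.prod_restrict, lintegral_prod_mul (g := fun _ => 1)]
  · rw [lintegral_indicator measurableSet_Iio, Measure.restrict_restrict measurableSet_Iio,
      Set.Iio_inter_Ioi, setLIntegral_one, Real.volume_Ioo, setLIntegral_congr Ioo_ae_eq_Ioc,
      ← ofReal_integral_eq_lintegral_ofReal (intervalIntegral.intervalIntegrable_pow _).1,
      ← intervalIntegral.integral_of_le zero_le_one, integral_pow, ← ENNReal.ofReal_mul]
    · congr 1
      push_cast
      field_simp
      ring
    · simp; positivity
    · filter_upwards [ae_restrict_mem measurableSet_Ioc] with y hy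
      exact pow_nonneg hy.1.le _
  · exact (Measurable.indicator (by fun_prop) measurableSet_Iio).aemeasurable
  · fun_prop

theorem lintegral_comp_inv_smul {n : ℕ} {Φ : (Fin n → ℂ) → ENNReal} (hΦ : Measurable Φ) {s : ℂ}
    (hs : s ≠ 0) : ∫⁻ x, Φ (s⁻¹ • x) = ENNReal.ofReal (‖s‖ ^ (2 * n)) * ∫⁻ y, Φ y := by
  have hdet : LinearMap.det (s⁻¹ • LinearMap.id : (Fin n → ℂ) →ₗ[ℂ] (Fin n → ℂ)) = (s ^ n)⁻¹ := by
    simp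
  rw [← lintegral_comp_complexLinear volume (s⁻¹ • LinearMap.id) (by rw [hdet]; simp [hs]) hΦ,
    hdet, ← mul_assoc, ← ENNReal.ofReal_mul (by positivity)]
  have : ‖s‖ ^ (2 * n) * ‖(s ^ n)⁻¹‖ ^ 2 = 1 := by
    rw [norm_inv, norm_pow, inv_pow, ← pow_mul, mul_comm n 2]
    exact mul_inv_cancel₀ (pow_ne_zero _ (norm_ne_zero_iff.2 hs))
  rw [this, ENNReal.ofReal_one, one_mul]
  rfl

theorem measurable_affineCoord {n : ℕ} : Measurable (affineCoord (n := n)) := by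
  unfold affineCoord
  fun_prop

/-- The domain is a cylinder, not a ball. For fixed first entry s, passing to affine coordinates has
Jacobian |s|^(2n), which leaves the disc integral of `lintegral_ball_norm_pow`. -/
theorem lintegral_comp_affineCoord_ball {n : ℕ} {Φ : (Fin n → ℂ) → ENNReal} (hΦ : Measurable Φ) :
    ∫⁻ x : Fin (n + 1) → ℂ, {x : Fin (n + 1) → ℂ | ‖x 0‖ < 1}.indicator
      (fun x => Φ (affineCoord x)) x = ENNReal.ofReal (2 * Real.pi / (2 * n + 2)) * ∫⁻ y, Φ y := by
  have hm : Measurable ({x : Fin (n + 1) → ℂ | ‖x 0‖ < 1}.indicator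
      fun x => Φ (affineCoord x)) :=
    (hΦ.comp measurable_affineCoord).indicator (measurableSet_lt (by fun_prop) measurable_const)
  rw [← (volume_preserving_piFinSuccAbove (fun _ : Fin (n + 1) => ℂ) 0).symm.lintegral_comp hm,
    Measure.volume_eq_prod, lintegral_prod]
  rotate_left
  · exact (hm.comp (MeasurableEquiv.measurable _)).aemeasurable
  rw [← lintegral_ball_norm_pow, ← lintegral_mul_const]
  · refine lintegral_congr_ae ?_
    filter_upwards [compl_mem_ae_iff.2 (measure_singleton (0 : ℂ))] with s hs
    have hs0 : s ≠ 0 := hs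
    by_cases h : ‖s‖ < 1
    · rw [Set.indicator_of_mem (by simpa using h), ← lintegral_comp_inv_smul hΦ hs0]
      refine lintegral_congr fun x => ?_
      rw [Set.indicator_of_mem (by simpa using h)]
      congr 1
      funext i
      simp [affineCoord, div_eq_inv_mul]
    · rw [Set.indicator_of_notMem (by simpa using h), zero_mul]
      refine lintegral_eq_zero_of_ae_eq_zero (Filter.Eventually.of_forall fun x => ?_)
      exact Set.indicator_of_notMem (by simpa using h) _
  · exact Measurable.indicator (by fun_prop) measurableSet_ball

instance (n : ℕ) : ((volume : Measure (Fin n → ℂ)).map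
    (WithLp.toLp 2 : (Fin n → ℂ) → EuclideanSpace ℂ (Fin n))).IsAddHaarMeasure :=
  (PiLp.continuousLinearEquiv 2 ℝ fun _ : Fin n => ℂ).symm.isAddHaarMeasure_map volume

instance (n : ℕ) : IsFiniteMeasure (sphereMeasure n) := by
  unfold sphereMeasure; infer_instance

/-- Integration in polar coordinates. -/
theorem lintegral_toLp_eq_sphereMeasure {n : ℕ} {F : EuclideanSpace ℂ (Fin (n + 1)) → ENNReal}
    (hF : Measurable F) :
    ∫⁻ x : Fin (n + 1) → ℂ, F (WithLp.toLp 2 x) = ∫⁻ v, (∫⁻ r : Set.Ioi (0 : ℝ), F (r.1 • v.1)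
      ∂Measure.volumeIoiPow (2 * n + 1)) ∂sphereMeasure (n + 1) := by
  set μ := (volume : Measure (Fin (n + 1) → ℂ)).map
    (WithLp.toLp 2 : (Fin (n + 1) → ℂ) → EuclideanSpace ℂ (Fin (n + 1))) with hμ
  have hd : Module.finrank ℝ (EuclideanSpace ℂ (Fin (n + 1))) - 1 = 2 * n + 1 := by
    rw [finrank_real_of_complex, finrank_euclideanSpace_fin]
    omega
  have hmp := μ.measurePreserving_homeomorphUnitSphereProd
  rw [hd] at hmp
  have h1 : Measurable fun p : UnitSphere (n + 1) × Set.Ioi (0 : ℝ) => F (p.2.1 • p.1.1) :=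
    hF.comp (by fun_prop)
  have h2 := hmp.lintegral_comp_emb (Homeomorph.measurableEmbedding _)
    fun p : UnitSphere (n + 1) × Set.Ioi (0 : ℝ) => F (p.2.1 • p.1.1)
  have h3 : ∀ x : ({0}ᶜ : Set (EuclideanSpace ℂ (Fin (n + 1)))),
      F ((homeomorphUnitSphereProd _ x).2.1 • (homeomorphUnitSphereProd _ x).1.1) = F x := by
    intro x
    have hx : ‖x.1‖ ≠ 0 := norm_ne_zero_iff.2 x.2
    simp [smul_smul, hx]
  simp only [h3] at h2
  rw [lintegral_prod _ h1.aemeasurable] at h2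
  rw [← lintegral_map hF (by fun_prop), ← hμ, ← restrict_compl_singleton (μ := μ) 0,
    ← lintegral_subtype_comap (measurableSet_singleton _).compl, h2]
  rfl

/-- The cone over the exceptional set lies in a null hyperplane, while every ray has positive radial
measure. -/
theorem ae_apply_zero_ne_zero (n : ℕ) :
    ∀ᵐ v : UnitSphere (n + 1) ∂sphereMeasure (n + 1), v.1 0 ≠ 0 := by
  let H : Set (EuclideanSpace ℂ (Fin (n + 1))) := {x | x 0 = 0}
  have hH : MeasurableSet H := measurableSet_eq_fun (by fun_prop) measurable_const
  have h1 := lintegral_toLp_eq_sphereMeasure (F := H.indicator 1) (measurable_one.indicator hH)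
  have h2 : ∫⁻ x : Fin (n + 1) → ℂ, H.indicator 1 (WithLp.toLp 2 x) = 0 := by
    have h3 : volume {x : Fin (n + 1) → ℂ | x 0 = 0} = 0 :=
      Measure.pi_hyperplane (fun _ : Fin (n + 1) => (volume : Measure ℂ)) 0 0
    rw [← h3, ← lintegral_indicator_one (measurableSet_eq_fun (by fun_prop) measurable_const)]
    rfl
  have hm : Measurable fun p : UnitSphere (n + 1) × Set.Ioi (0 : ℝ) =>
      H.indicator (1 : EuclideanSpace ℂ (Fin (n + 1)) → ENNReal) (p.2.1 • p.1.1) :=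
    (measurable_one.indicator hH).comp (by fun_prop)
  rw [h2, eq_comm, lintegral_eq_zero_iff hm.lintegral_prod_right'] at h1
  filter_upwards [h1] with v hv h0
  have h4 : ∀ r : Set.Ioi (0 : ℝ),
      H.indicator (1 : EuclideanSpace ℂ (Fin (n + 1)) → ENNReal) (r.1 • v.1) = 1 := fun r =>
    Set.indicator_of_mem (by simp [H, h0]) _
  simp only [h4, Pi.zero_apply, lintegral_one] at hv
  have h5 := measure_mono_null (Set.subset_univ (Set.Iio ⟨1, Set.mem_Ioi.2 one_pos⟩)) hv
  rw [Measure.volumeIoiPow_apply_Iio, ENNReal.ofReal_eq_zero] at h5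
  exact absurd h5 (not_le.2 (by positivity))

/-- The cylinder |x₀| < 1 is integrated in two ways. Affine coordinates give 2π/(2n+2). In polar
coordinates the ray through v stays inside for r < 1/|v₀|, with radial mass |v₀|^(-(2n+2))/(2n+2),
so the weight attached to `G` cancels. -/
theorem lintegral_sphereMeasure_affineCoord {n : ℕ} {Φ : (Fin n → ℂ) → ENNReal}
    (hΦ : Measurable Φ) {G : UnitSphere (n + 1) → ENNReal}
    (hG : ∀ v : UnitSphere (n + 1), v.1 0 ≠ 0 →
      ENNReal.ofReal (‖v.1 0‖ ^ (2 * n + 2)) * G v = Φ (affineCoord v.1)) :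
    ∫⁻ v, G v ∂sphereMeasure (n + 1) = ENNReal.ofReal (2 * Real.pi) * ∫⁻ y, Φ y := by
  let U : Set (EuclideanSpace ℂ (Fin (n + 1))) := {x | ‖x 0‖ < 1}
  have hU : MeasurableSet U := measurableSet_lt (by fun_prop) measurable_const
  have hm : Measurable fun x : EuclideanSpace ℂ (Fin (n + 1)) => Φ (affineCoord x) :=
    hΦ.comp (measurable_affineCoord.comp (by fun_prop))
  have h1 := lintegral_toLp_eq_sphereMeasure (hm.indicator hU)
  have h2 : ∫⁻ v, (∫⁻ r : Set.Ioi (0 : ℝ), U.indicator (fun x => Φ (affineCoord x)) (r.1 • v.1)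
      ∂Measure.volumeIoiPow (2 * n + 1)) ∂sphereMeasure (n + 1) =
      ∫⁻ v, ENNReal.ofReal (1 / (2 * n + 2)) * G v ∂sphereMeasure (n + 1) := by
    refine lintegral_congr_ae ?_
    filter_upwards [ae_apply_zero_ne_zero n] with v hv
    have hv' : 0 < ‖v.1 0‖ := norm_pos_iff.2 hv
    have h3 : ∀ r : Set.Ioi (0 : ℝ), U.indicator (fun x => Φ (affineCoord x)) (r.1 • v.1) =
        (Set.Iio (⟨‖v.1 0‖⁻¹, Set.mem_Ioi.2 (inv_pos.2 hv')⟩ : Set.Ioi (0 : ℝ))).indicator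
          (fun _ => Φ (affineCoord v.1)) r := by
      intro r
      have hr : 0 < r.1 := r.2
      have hiff : r.1 • v.1 ∈ U ↔ r.1 < ‖v.1 0‖⁻¹ := by
        rw [lt_inv_comm₀ hr hv', ← one_div, lt_div_iff₀ hr, mul_comm]
        simp [U, abs_of_pos hr]
      by_cases h : r.1 < ‖v.1 0‖⁻¹
      · rw [Set.indicator_of_mem (hiff.2 h), Set.indicator_of_mem (by exact h)]
        congr 1
        funext i
        have : (r.1 : ℂ) ≠ 0 := by exact_mod_cast hr.ne'
        simp [affineCoord, mul_div_mul_left _ _ this]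
      · rw [Set.indicator_of_notMem (fun h' => h (hiff.1 h')), Set.indicator_of_notMem (by exact h)]
    simp only [h3]
    rw [lintegral_indicator_const measurableSet_Iio, Measure.volumeIoiPow_apply_Iio, ← hG v hv,
      mul_right_comm, ← ENNReal.ofReal_mul (by positivity)]
    congr 2
    have : ‖v.1 0‖ ^ (2 * n + 2) * ‖v.1 0‖⁻¹ ^ (2 * n + 1 + 1) = 1 := by
      rw [← mul_pow, mul_inv_cancel₀ hv'.ne', one_pow]
    dsimp only
    rw [← mul_div_assoc, this]
    push_cast
    ring
  have h4 := (h1.symm.trans (lintegral_comp_affineCoord_ball hΦ))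
  rw [h2, lintegral_const_mul' _ _ ENNReal.ofReal_ne_top] at h4
  have hpos : (0 : ℝ) < 1 / (2 * n + 2) := by positivity
  refine (ENNReal.mul_right_inj (ENNReal.ofReal_pos.2 hpos).ne' ENNReal.ofReal_ne_top).1 ?_
  rw [h4, ← mul_assoc, ← ENNReal.ofReal_mul hpos.le]
  congr 2
  ring

/-! ### One step of the Schur decomposition -/

section Measurability

variable {n : ℕ} {X : Type*} [MeasurableSpace X]

@[fun_prop]
theorem Measurable.householder {v : X → EuclideanSpace ℂ (Fin (n + 1))} (hv : Measurable v) :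
    Measurable fun x => _root_.householder (v x) := by
  have h1 : Measurable fun v : EuclideanSpace ℂ (Fin (n + 1)) => phaseNormalize v := by
    unfold phaseNormalize
    refine Measurable.ite (measurableSet_eq_fun (by fun_prop) measurable_const) measurable_id ?_
    fun_prop
  have h2 : Measurable fun x => phaseNormalize (v x) - EuclideanSpace.single 0 (1 : ℂ) :=
    (h1.comp hv).sub measurable_const
  refine measurable_matrix_iff.2 fun i j => measurable_const.sub (Measurable.mul ?_ ?_)
  · fun_prop
  · simp only [vecMulVec_apply, Pi.star_apply]
    fun_prop

@[fun_prop]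
theorem Measurable.schurStep {z : X → ℂ} {v : X → UnitSphere (n + 1)} {w : X → Fin n → ℂ}
    {A : X → Matrix (Fin n) (Fin n) ℂ} (hz : Measurable z) (hv : Measurable v) (hw : Measurable w)
    (hA : Measurable A) : Measurable fun x => _root_.schurStep (z x) (v x) (w x) (A x) := by
  unfold _root_.schurStep
  simp only [schurBlock_eq]
  fun_prop

end Measurability

theorem det_scalar_sub_schurStep {n : ℕ} (ζ z : ℂ) (v : UnitSphere (n + 1)) (w : Fin n → ℂ)
    (A : Matrix (Fin n) (Fin n) ℂ) :
    (scalar (Fin (n + 1)) ζ - schurStep z v w A).det = (ζ - z) * (scalar (Fin n) ζ - A).det := by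
  rw [schurStep, det_conj_eq (householder_mul_self v.1), schurBlock_eq,
    det_scalar_sub_borderedMatrix]

theorem measurePreserving_star (n : ℕ) :
    MeasurePreserving (fun w : Fin n → ℂ => star w) volume volume :=
  volume_preserving_pi fun _ => Complex.conjLIE.measurePreserving

theorem lintegral_borderMeasure {n : ℕ} {f : BorderCoord n → ENNReal} (hf : Measurable f) :
    ∫⁻ t, f t ∂borderMeasure n =
      ∫⁻ z, (∫⁻ w : Fin n → ℂ, (∫⁻ A, f (w, A, z) ∂matrixLebesgue n)) := by
  have h1 : Measurable fun p : (Fin n → ℂ) × ℂ => ∫⁻ A, f (p.1, A, p.2) ∂matrixLebesgue n :=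
    Measurable.lintegral_prod_right' (f := fun q : ((Fin n → ℂ) × ℂ) × Matrix (Fin n) (Fin n) ℂ =>
      f (q.1.1, q.2, q.1.2)) (hf.comp (by fun_prop))
  rw [borderMeasure, lintegral_prod _ hf.aemeasurable]
  refine Eq.trans ?_ (lintegral_lintegral_swap h1.aemeasurable)
  refine lintegral_congr fun w => ?_
  exact lintegral_prod_symm _ (hf.comp measurable_prodMk_left).aemeasurable

theorem measurable_lintegral_deflatedIntegrand {n k : ℕ} {Y : Type*} [MeasurableSpace Y]
    {F : (Fin (k + 1) → ℂ) → Matrix (Fin (n + 1)) (Fin (n + 1)) ℂ → ENNReal}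
    (hF : Measurable (Function.uncurry F)) {S T : Y → Matrix (Fin (n + 1)) (Fin (n + 1)) ℂ}
    {w : Y → Fin n → ℂ} {z : Y → ℂ} (hS : Measurable S) (hT : Measurable T) (hw : Measurable w)
    (hz : Measurable z) :
    Measurable fun y => ∫⁻ A, deflatedIntegrand F ((S y, T y), (w y, A, z y)) ∂matrixLebesgue n :=
  Measurable.lintegral_prod_right' (f := fun q : Y × Matrix (Fin n) (Fin n) ℂ =>
    deflatedIntegrand F ((S q.1, T q.1), (w q.1, q.2, z q.1)))
    ((measurable_deflatedIntegrand hF).comp (by fun_prop))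

theorem deflatedIntegrand_householder {n k : ℕ}
    (F : (Fin (k + 1) → ℂ) → Matrix (Fin (n + 1)) (Fin (n + 1)) ℂ → ENNReal) (z : ℂ)
    (v : UnitSphere (n + 1)) (w : Fin n → ℂ) (A : Matrix (Fin n) (Fin n) ℂ) :
    deflatedIntegrand F ((householder v.1, householder v.1), (star w, A, z)) =
      tupleSum k (fun z' => charpolyNormSq z A * F (Fin.cons z z') (schurStep z v w A))
        (eigenvalueTuple A) := by
  simp only [deflatedIntegrand, deflatedTupleSum, tupleSum, Finset.mul_sum, inflate, schurStep,
    schurBlock_eq]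

/-- The affine splitting is moved to the sphere: the conjugation Jacobian meets the same power of
|v₀| in the surface measure, and only 2π remains. Conjugating w, which preserves Lebesgue measure,
accounts for w* in `schurBlock`. -/
theorem lintegral_tupleSum_schurStep {n k : ℕ}
    {F : (Fin (k + 1) → ℂ) → Matrix (Fin (n + 1)) (Fin (n + 1)) ℂ → ENNReal}
    (hF : Measurable (Function.uncurry F)) :
    ENNReal.ofReal (2 * Real.pi) *
      ∫⁻ M, tupleSum (k + 1) (fun z => F z M) (eigenvalueTuple M) ∂matrixLebesgue (n + 1) =
      ∫⁻ z, (∫⁻ v, (∫⁻ w : Fin n → ℂ, (∫⁻ A, tupleSum k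
        (fun z' => charpolyNormSq z A * F (Fin.cons z z') (schurStep z v w A)) (eigenvalueTuple A)
          ∂matrixLebesgue n)) ∂sphereMeasure (n + 1)) := by
  have h2 : Measurable fun p : ℂ × (Fin n → ℂ) => ∫⁻ w : Fin n → ℂ, (∫⁻ A,
      deflatedIntegrand F ((shear p.2, shear (-p.2)), (w, A, p.1)) ∂matrixLebesgue n) :=
    Measurable.lintegral_prod_right' (f := fun q : (ℂ × (Fin n → ℂ)) × (Fin n → ℂ) =>
      ∫⁻ A, deflatedIntegrand F ((shear q.1.2, shear (-q.1.2)), (q.2, A, q.1.1)) ∂matrixLebesgue n)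
      (measurable_lintegral_deflatedIntegrand hF (by fun_prop) (by fun_prop) (by fun_prop)
        (by fun_prop))
  have hy : ∀ y : Fin n → ℂ,
      ∫⁻ t, deflatedIntegrand F ((shear y, shear (-y)), t) ∂borderMeasure n =
      ∫⁻ z, (∫⁻ w : Fin n → ℂ, (∫⁻ A, deflatedIntegrand F ((shear y, shear (-y)), (w, A, z))
        ∂matrixLebesgue n)) := fun y =>
    lintegral_borderMeasure ((measurable_deflatedIntegrand hF).comp measurable_prodMk_left)
  rw [lintegral_tupleSum_eigenvalueTuple hF, lintegral_congr hy,
    ← lintegral_lintegral_swap h2.aemeasurable, ← lintegral_const_mul' _ _ ENNReal.ofReal_ne_top]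
  refine lintegral_congr fun z => ?_
  have h4 : Measurable fun y : Fin n → ℂ => ∫⁻ w : Fin n → ℂ, (∫⁻ A,
      deflatedIntegrand F ((shear y, shear (-y)), (w, A, z)) ∂matrixLebesgue n) :=
    Measurable.lintegral_prod_right' (f := fun q : (Fin n → ℂ) × (Fin n → ℂ) =>
      ∫⁻ A, deflatedIntegrand F ((shear q.1, shear (-q.1)), (q.2, A, z)) ∂matrixLebesgue n)
      (measurable_lintegral_deflatedIntegrand hF (by fun_prop) (by fun_prop) (by fun_prop)
        (by fun_prop))
  rw [← lintegral_sphereMeasure_affineCoord h4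
    (G := fun v => ∫⁻ w : Fin n → ℂ, (∫⁻ A,
      deflatedIntegrand F ((householder v.1, householder v.1), (w, A, z)) ∂matrixLebesgue n))
    fun v hv => lintegral_deflatedIntegrand_householder hF (norm_eq_of_mem_sphere v) hv z]
  refine lintegral_congr fun v => ?_
  have h5 : Measurable fun w : Fin n → ℂ => ∫⁻ A,
      deflatedIntegrand F ((householder v.1, householder v.1), (w, A, z)) ∂matrixLebesgue n :=
    measurable_lintegral_deflatedIntegrand hF measurable_const measurable_const measurable_id
      measurable_const
  refine ((measurePreserving_star n).lintegral_comp h5).symm.trans ?_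
  exact lintegral_congr fun w => lintegral_congr fun A => deflatedIntegrand_householder F z v w A

/-! ### The partial Schur decomposition -/

section SchurCoord

variable {m k : ℕ}

instance SchurCoord.sigmaFinite (m k : ℕ) : SigmaFinite (SchurCoord.measure m k) := by
  induction k with
  | zero => exact inferInstanceAs (SigmaFinite (matrixLebesgue m))
  | succ k ih =>
    have : SigmaFinite ((volume : Measure (Fin (m + k) → ℂ)).prod (SchurCoord.measure m k)) :=
      Measure.prod.instSigmaFinite
    exact Measure.prod.instSigmaFinite (μ := sphereMeasure (m + k + 1))
      (ν := (volume : Measure (Fin (m + k) → ℂ)).prod (SchurCoord.measure m k))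

theorem SchurCoord.measurable_residual : ∀ {k : ℕ},
    Measurable (SchurCoord.residual : SchurCoord m k → Matrix (Fin m) (Fin m) ℂ)
  | 0 => measurable_id
  | k + 1 => by
    change Measurable fun x : UnitSphere (m + k + 1) × (Fin (m + k) → ℂ) × SchurCoord m k =>
      SchurCoord.residual x.2.2
    exact SchurCoord.measurable_residual.comp (by fun_prop)

theorem measurable_partialSchur : ∀ {k : ℕ},
    Measurable fun p : (Fin k → ℂ) × SchurCoord m k => partialSchur p.1 p.2
  | 0 => measurable_snd
  | k + 1 => by
    change Measurable fun p : (Fin (k + 1) → ℂ) ×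
        (UnitSphere (m + k + 1) × (Fin (m + k) → ℂ) × SchurCoord m k) =>
      schurStep (p.1 0) p.2.1 p.2.2.1 (partialSchur (Fin.tail p.1) p.2.2.2)
    have h1 : Measurable fun p : (Fin (k + 1) → ℂ) ×
        (UnitSphere (m + k + 1) × (Fin (m + k) → ℂ) × SchurCoord m k) =>
        (Fin.tail p.1, p.2.2.2) := by
      unfold Fin.tail
      fun_prop
    have h2 := measurable_partialSchur.comp h1
    exact Measurable.schurStep (by fun_prop) (by fun_prop) (by fun_prop) h2

theorem lintegral_schurCoord_succ {f : SchurCoord m (k + 1) → ENNReal} (hf : Measurable f) :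
    ∫⁻ x, f x ∂SchurCoord.measure m (k + 1) =
      ∫⁻ v, (∫⁻ w : Fin (m + k) → ℂ, (∫⁻ x, f (v, w, x) ∂SchurCoord.measure m k))
        ∂sphereMeasure (m + k + 1) := by
  refine (lintegral_prod (μ := sphereMeasure (m + k + 1))
    (ν := (volume : Measure (Fin (m + k) → ℂ)).prod (SchurCoord.measure m k)) f
    hf.aemeasurable).trans ?_
  refine lintegral_congr fun v => ?_
  exact lintegral_prod _ (hf.comp (measurable_prodMk_left (x := v))).aemeasurable

theorem lintegral_fin_succ_complex {f : (Fin (k + 1) → ℂ) → ENNReal} (hf : Measurable f) :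
    ∫⁻ z, f z = ∫⁻ z, (∫⁻ z', f (Fin.cons z z')) := by
  rw [← (volume_preserving_piFinSuccAbove (fun _ : Fin (k + 1) => ℂ) 0).symm.lintegral_comp hf,
    Measure.volume_eq_prod, lintegral_prod]
  · refine lintegral_congr fun z => lintegral_congr fun z' => ?_
    congr 1
    funext i
    refine Fin.cases ?_ (fun i => ?_) i <;> simp
  · exact (hf.comp (MeasurableEquiv.measurable _)).aemeasurable

/-- The weight `∏ i, |det (z_i - M^{(k)})|²`. -/
def residualWeight (z : Fin k → ℂ) (x : SchurCoord m k) : ENNReal :=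
  ∏ i, charpolyNormSq (z i) x.residual

theorem measurable_residualWeight :
    Measurable fun p : (Fin k → ℂ) × SchurCoord m k => residualWeight p.1 p.2 := by
  have h : Measurable fun p : (Fin k → ℂ) × SchurCoord m k => p.2.residual :=
    SchurCoord.measurable_residual.comp measurable_snd
  exact Finset.measurable_fun_prod _ fun i _ => Measurable.charpolyNormSq (by fun_prop) h

theorem charpolyNormSq_schurStep {n : ℕ} (ζ z : ℂ) (v : UnitSphere (n + 1)) (w : Fin n → ℂ)
    (A : Matrix (Fin n) (Fin n) ℂ) :
    charpolyNormSq ζ (schurStep z v w A) = ENNReal.ofReal (‖ζ - z‖ ^ 2) * charpolyNormSq ζ A := by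
  rw [charpolyNormSq, charpolyNormSq, det_scalar_sub_schurStep, norm_mul, mul_pow,
    ENNReal.ofReal_mul (by positivity)]

theorem charpolyNormSq_partialSchur (ζ : ℂ) : ∀ {k : ℕ} (z : Fin k → ℂ) (x : SchurCoord m k),
    charpolyNormSq ζ (partialSchur z x) =
      (∏ i, ENNReal.ofReal (‖ζ - z i‖ ^ 2)) * charpolyNormSq ζ x.residual
  | 0, _, A => by simp [partialSchur, SchurCoord.residual]
  | k + 1, z, (v, w, x) => by
    simp only [partialSchur, SchurCoord.residual]
    rw [charpolyNormSq_schurStep, charpolyNormSq_partialSchur ζ (Fin.tail z) x, Fin.prod_univ_succ,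
      mul_assoc]
    rfl

theorem vandermondeNormSq_nonneg (z : Fin k → ℂ) : 0 ≤ vandermondeNormSq z :=
  Finset.prod_nonneg fun _ _ => Finset.prod_nonneg fun _ _ => by positivity

theorem vandermondeNormSq_cons (z : ℂ) (z' : Fin k → ℂ) :
    vandermondeNormSq (Fin.cons z z' : Fin (k + 1) → ℂ) =
      (∏ i, ‖z - z' i‖ ^ 2) * vandermondeNormSq z' := by
  unfold vandermondeNormSq
  rw [Fin.prod_univ_succ]
  congr 1
  · rw [Fin.Ioi_zero_eq_map, Finset.prod_map]
    simp [norm_sub_rev]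
  · refine Finset.prod_congr rfl fun i _ => ?_
    rw [← Fin.map_succEmb_Ioi, Finset.prod_map]
    simp

theorem measurable_vandermondeNormSq :
    Measurable (vandermondeNormSq : (Fin k → ℂ) → ℝ) := by
  unfold vandermondeNormSq
  fun_prop

end SchurCoord

section

variable {m k : ℕ}

/-- The integrand of the correlation function, for a function of tuple and matrix. -/
def schurLIntegrand (F : (Fin k → ℂ) → Matrix (Fin (m + k)) (Fin (m + k)) ℂ → ENNReal)
    (z : Fin k → ℂ) (x : SchurCoord m k) : ENNReal :=
  ENNReal.ofReal (vandermondeNormSq z) * (residualWeight z x * F z (partialSchur z x))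

theorem measurable_schurLIntegrand
    {F : (Fin k → ℂ) → Matrix (Fin (m + k)) (Fin (m + k)) ℂ → ENNReal}
    (hF : Measurable (Function.uncurry F)) :
    Measurable fun p : (Fin k → ℂ) × SchurCoord m k => schurLIntegrand F p.1 p.2 := by
  have h1 : Measurable fun p : (Fin k → ℂ) × SchurCoord m k => (p.1, partialSchur p.1 p.2) :=
    measurable_fst.prodMk measurable_partialSchur
  exact (measurable_vandermondeNormSq.ennreal_ofReal.comp measurable_fst).mul
    (measurable_residualWeight.mul (hF.comp h1))

/-- The weight of the new step is the characteristic polynomial, at z, of a matrix already in Schur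
form. It supplies at once the new Vandermonde factors and the new residual factor. -/
theorem schurLIntegrand_succ
    (F : (Fin (k + 1) → ℂ) → Matrix (Fin (m + k + 1)) (Fin (m + k + 1)) ℂ → ENNReal) (z : ℂ)
    (z' : Fin k → ℂ) (v : UnitSphere (m + k + 1)) (w : Fin (m + k) → ℂ) (x : SchurCoord m k) :
    schurLIntegrand (m := m) (k := k + 1) F (Fin.cons z z') (v, w, x) =
      schurLIntegrand (fun z' A => charpolyNormSq z A * F (Fin.cons z z') (schurStep z v w A))
        z' x := by
  have h1 : residualWeight (m := m) (k := k + 1) (Fin.cons z z') (v, w, x) =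
      charpolyNormSq z x.residual * residualWeight z' x := Fin.prod_univ_succ _
  have h2 : partialSchur (m := m) (k := k + 1) (Fin.cons z z') (v, w, x) =
    schurStep z v w (partialSchur z' x) := rfl
  simp only [schurLIntegrand, h1, h2]
  rw [vandermondeNormSq_cons, charpolyNormSq_partialSchur, ENNReal.ofReal_mul (by positivity),
    ENNReal.ofReal_prod_of_nonneg fun _ _ => by positivity]
  ring

end

/-- The sum over eigenvalue tuples in partial Schur coordinates. -/
theorem lintegral_tupleSum_partialSchur (m : ℕ) : ∀ (k : ℕ)
    {F : (Fin k → ℂ) → Matrix (Fin (m + k)) (Fin (m + k)) ℂ → ENNReal},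
    Measurable (Function.uncurry F) → ENNReal.ofReal ((2 * Real.pi) ^ k) *
      ∫⁻ M, tupleSum k (fun z => F z M) (eigenvalueTuple M) ∂matrixLebesgue (m + k) =
    ∫⁻ z, (∫⁻ x, schurLIntegrand F z x ∂SchurCoord.measure m k)
  | 0, F, hF => by
    have h1 : ∀ M, tupleSum 0 (fun z => F z M) (eigenvalueTuple M) = F default M := fun M => by
      rw [tupleSum, Fintype.sum_unique]
      exact congrArg (fun z => F z M) (Subsingleton.elim _ _)
    have h2 : ∀ M, schurLIntegrand F default M = F default M := fun M => by
      simp [schurLIntegrand, vandermondeNormSq, residualWeight, partialSchur]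
    -- Lebesgue measure on ℂ⁰ is the Dirac mass at the empty tuple.
    rw [volume_pi, Measure.pi_of_empty _ default, lintegral_dirac]
    simp only [h1, h2, pow_zero, ENNReal.ofReal_one, one_mul]
    rfl
  | k + 1, F, hF => by
    have hH := measurable_schurLIntegrand hF
    have hcons : Measurable fun q : ((ℂ × (Fin k → ℂ)) × (UnitSphere (m + k + 1) ×
        (Fin (m + k) → ℂ))) × SchurCoord m k => ((Fin.cons q.1.1.1 q.1.1.2 : Fin (k + 1) → ℂ),
          ((q.1.2.1, q.1.2.2, q.2) : SchurCoord m (k + 1))) :=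
      Measurable.prodMk (by fun_prop)
        (Measurable.prodMk (by fun_prop) (Measurable.prodMk (by fun_prop) (by fun_prop)))
    have hg : Measurable fun p : (ℂ × (Fin k → ℂ)) × (UnitSphere (m + k + 1) ×
        (Fin (m + k) → ℂ)) => ∫⁻ x, schurLIntegrand (m := m) (k := k + 1) F
          (Fin.cons p.1.1 p.1.2) (p.2.1, p.2.2, x) ∂SchurCoord.measure m k :=
      (hH.comp hcons).lintegral_prod_right'
    -- The induction hypothesis is used with z, v, w frozen, for a function that has absorbed the
    -- weight and the outer Schur step; hence the generality in `F`.
    have hstep : ∀ z v w, ENNReal.ofReal ((2 * Real.pi) ^ k) * ∫⁻ A, tupleSum k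
        (fun z' => charpolyNormSq z A * F (Fin.cons z z') (schurStep z v w A)) (eigenvalueTuple A)
          ∂matrixLebesgue (m + k) =
        ∫⁻ z', (∫⁻ x, schurLIntegrand (m := m) (k := k + 1) F
          (Fin.cons z z') (v, w, x) ∂SchurCoord.measure m k) := fun z v w => by
      have hF' : Measurable (Function.uncurry fun (z' : Fin k → ℂ)
          (A : Matrix (Fin (m + k)) (Fin (m + k)) ℂ) =>
          charpolyNormSq z A * F (Fin.cons z z') (schurStep z v w A)) := by
        have h1 : Measurable fun p : (Fin k → ℂ) × Matrix (Fin (m + k)) (Fin (m + k)) ℂ =>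
          ((Fin.cons z p.1 : Fin (k + 1) → ℂ), schurStep z v w p.2) := by fun_prop
        exact Measurable.mul (by fun_prop) (hF.comp h1)
      rw [lintegral_tupleSum_partialSchur m k hF']
      exact lintegral_congr fun z' => lintegral_congr fun x =>
        (schurLIntegrand_succ F z z' v w x).symm
    rw [pow_succ, ENNReal.ofReal_mul (by positivity), mul_assoc]
    refine (congrArg _ (lintegral_tupleSum_schurStep hF)).trans ?_
    rw [lintegral_fin_succ_complex hH.lintegral_prod_right',
      ← lintegral_const_mul' _ _ ENNReal.ofReal_ne_top]
    refine lintegral_congr fun z => ?_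
    have hw : Measurable fun p : UnitSphere (m + k + 1) × (Fin k → ℂ) =>
        ∫⁻ w : Fin (m + k) → ℂ, (∫⁻ x, schurLIntegrand (m := m) (k := k + 1) F
          (Fin.cons z p.2) (p.1, w, x) ∂SchurCoord.measure m k) := by
      have h1 : Measurable fun q : (UnitSphere (m + k + 1) × (Fin k → ℂ)) × (Fin (m + k) → ℂ) =>
        ((z, q.1.2), (q.1.1, q.2)) := by fun_prop
      exact (hg.comp h1).lintegral_prod_right'
    calc _ = ∫⁻ v, (∫⁻ w : Fin (m + k) → ℂ, (∫⁻ z', (∫⁻ x, schurLIntegrand (m := m) (k := k + 1) F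
          (Fin.cons z z') (v, w, x) ∂SchurCoord.measure m k))) ∂sphereMeasure (m + k + 1) := by
          rw [← lintegral_const_mul' _ _ ENNReal.ofReal_ne_top]
          refine lintegral_congr fun v => ?_
          rw [← lintegral_const_mul' _ _ ENNReal.ofReal_ne_top]
          exact lintegral_congr fun w => hstep z v w
      _ = ∫⁻ v, (∫⁻ z', (∫⁻ w : Fin (m + k) → ℂ, (∫⁻ x, schurLIntegrand (m := m) (k := k + 1) F
          (Fin.cons z z') (v, w, x) ∂SchurCoord.measure m k))) ∂sphereMeasure (m + k + 1) := by
          refine lintegral_congr fun v => lintegral_lintegral_swap ?_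
          have h1 : Measurable fun q : (Fin (m + k) → ℂ) × (Fin k → ℂ) =>
            ((z, q.2), (v, q.1)) := by fun_prop
          exact (hg.comp h1).aemeasurable
      _ = ∫⁻ z', (∫⁻ v, (∫⁻ w : Fin (m + k) → ℂ, (∫⁻ x, schurLIntegrand (m := m) (k := k + 1) F
          (Fin.cons z z') (v, w, x) ∂SchurCoord.measure m k)) ∂sphereMeasure (m + k + 1)) :=
          lintegral_lintegral_swap hw.aemeasurable
      _ = _ := lintegral_congr fun z' =>
          (lintegral_schurCoord_succ (hH.comp measurable_prodMk_left)).symm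

/-! ### The correlation function -/

section

variable {m k : ℕ}

/-- Finiteness is first obtained for the inner integral multiplied by the Vandermonde factor; this
lets that factor be divided out. -/
theorem ae_vandermondeNormSq_ne_zero (k : ℕ) : ∀ᵐ z : Fin k → ℂ, vandermondeNormSq z ≠ 0 := by
  have h : ∀ i j : Fin k, ∀ᵐ z : Fin k → ℂ, i ≠ j → z j - z i ≠ 0 := by
    intro i j
    by_cases hij : i = j
    · exact Filter.Eventually.of_forall fun z h => absurd hij h
    · let ℓ : (Fin k → ℂ) →ₗ[ℝ] ℂ :=
        (LinearMap.proj j : (Fin k → ℂ) →ₗ[ℝ] ℂ) - LinearMap.proj i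
      have hne : LinearMap.ker ℓ ≠ ⊤ := by
        intro h
        have h1 : (Pi.single j 1 : Fin k → ℂ) ∈ LinearMap.ker ℓ := h ▸ Submodule.mem_top
        simp [ℓ, hij] at h1
      have := Measure.addHaar_submodule (volume : Measure (Fin k → ℂ)) _ hne
      rw [measure_eq_zero_iff_ae_notMem] at this
      filter_upwards [this] with z hz _ h0
      exact hz h0
  filter_upwards [ae_all_iff.2 fun i => ae_all_iff.2 (h i)] with z hz
  refine Finset.prod_ne_zero_iff.2 fun i _ => Finset.prod_ne_zero_iff.2 fun j hj => ?_
  exact pow_ne_zero _ (norm_ne_zero_iff.2 (hz i j (Finset.mem_Ioi.1 hj).ne))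

/-- The candidate for the correlation function. -/
def schurCorrelation (ρ : Matrix (Fin (m + k)) (Fin (m + k)) ℂ → ℝ) (z : Fin k → ℂ) : ℝ :=
  vandermondeNormSq z / (2 * Real.pi) ^ k *
    ∫ x, schurIntegrand ρ z x ∂(SchurCoord.measure m k)

variable {ρ : Matrix (Fin (m + k)) (Fin (m + k)) ℂ → ℝ}

theorem schurIntegrand_nonneg (hρ0 : ∀ A, 0 ≤ ρ A) (z : Fin k → ℂ) (x : SchurCoord m k) :
    0 ≤ schurIntegrand ρ z x :=
  mul_nonneg (hρ0 _) (Finset.prod_nonneg fun _ _ => by positivity)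

theorem schurCorrelation_nonneg (hρ0 : ∀ A, 0 ≤ ρ A) (z : Fin k → ℂ) :
    0 ≤ schurCorrelation ρ z :=
  mul_nonneg (div_nonneg (vandermondeNormSq_nonneg z) (by positivity))
    (integral_nonneg fun x => schurIntegrand_nonneg hρ0 z x)

theorem measurable_schurIntegrand (hρ : Measurable ρ) :
    Measurable fun p : (Fin k → ℂ) × SchurCoord m k => schurIntegrand ρ p.1 p.2 := by
  have h : Measurable fun p : (Fin k → ℂ) × SchurCoord m k => p.2.residual :=
    SchurCoord.measurable_residual.comp measurable_snd
  refine (hρ.comp measurable_partialSchur).mul (Finset.measurable_fun_prod _ fun i _ => ?_)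
  have h1 : Measurable fun p : (Fin k → ℂ) × SchurCoord m k => (p.1 i, p.2.residual) :=
    Measurable.prodMk (by fun_prop) h
  exact ((continuous_det_scalar_sub.measurable.comp h1).norm.pow_const 2)

theorem measurable_schurCorrelation (hρ : Measurable ρ) :
    Measurable (schurCorrelation ρ : (Fin k → ℂ) → ℝ) :=
  (measurable_vandermondeNormSq.div_const _).mul
    (measurable_schurIntegrand hρ).stronglyMeasurable.integral_prod_right'.measurable

theorem schurLIntegrand_eq (hρ0 : ∀ A, 0 ≤ ρ A) (f : (Fin k → ℂ) → ENNReal) (z : Fin k → ℂ)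
    (x : SchurCoord m k) :
    schurLIntegrand (fun z A => f z * ENNReal.ofReal (ρ A)) z x =
      f z * ENNReal.ofReal (vandermondeNormSq z) * ENNReal.ofReal (schurIntegrand ρ z x) := by
  rw [schurIntegrand, ENNReal.ofReal_mul (hρ0 _), schurLIntegrand,
    ENNReal.ofReal_prod_of_nonneg fun _ _ => by positivity]
  simp only [residualWeight, charpolyNormSq]
  ring

theorem lintegral_tupleSum_mul (hρ : Measurable ρ) (hρ0 : ∀ A, 0 ≤ ρ A)
    {f : (Fin k → ℂ) → ENNReal} (hf : Measurable f) :
    ENNReal.ofReal ((2 * Real.pi) ^ k) * ∫⁻ A, tupleSum k f (eigenvalueTuple A) *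
      ENNReal.ofReal (ρ A) ∂matrixLebesgue (m + k) =
    ∫⁻ z, f z * ENNReal.ofReal (vandermondeNormSq z) *
      ∫⁻ x, ENNReal.ofReal (schurIntegrand ρ z x) ∂SchurCoord.measure m k := by
  have hF : Measurable (Function.uncurry fun (z : Fin k → ℂ)
      (A : Matrix (Fin (m + k)) (Fin (m + k)) ℂ) => f z * ENNReal.ofReal (ρ A)) := by
    unfold Function.uncurry
    fun_prop
  have h := lintegral_tupleSum_partialSchur m k hF
  simp only [tupleSum, ← Finset.sum_mul] at h ⊢
  rw [h]
  refine lintegral_congr fun z => ?_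
  simp only [schurLIntegrand_eq hρ0]
  exact lintegral_const_mul _
    ((measurable_schurIntegrand hρ).comp measurable_prodMk_left).ennreal_ofReal

theorem tupleSum_one (n k : ℕ) (e : Fin n → ℂ) :
    tupleSum k (fun _ => (1 : ENNReal)) e = Fintype.card (Fin k ↪ Fin n) := by
  simp [tupleSum]

variable {Ω : Type*} [MeasurableSpace Ω] {P : Measure Ω}
  {M : Ω → Matrix (Fin (m + k)) (Fin (m + k)) ℂ}

theorem lintegral_density (hM : Measurable M) (hρ : Measurable ρ)
    (hlaw : P.map M = (matrixLebesgue (m + k)).withDensity fun A => ENNReal.ofReal (ρ A))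
    {g : Matrix (Fin (m + k)) (Fin (m + k)) ℂ → ENNReal} (hg : Measurable g) :
    ∫⁻ A, g A * ENNReal.ofReal (ρ A) ∂matrixLebesgue (m + k) = ∫⁻ ω, g (M ω) ∂P := by
  rw [← lintegral_map hg hM, hlaw, lintegral_withDensity_eq_lintegral_mul _ hρ.ennreal_ofReal hg]
  exact lintegral_congr fun A => mul_comm _ _

theorem IsCorrelationFunction.ae_eq {r r' : (Fin k → ℂ) → ℝ} (h : IsCorrelationFunction P M k r)
    (h' : IsCorrelationFunction P M k r') : r =ᵐ[volume] r' := by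
  refine Integrable.ae_eq_of_forall_setIntegral_eq _ _ h.integrable h'.integrable fun s hs _ => ?_
  have hm : Measurable (s.indicator fun _ => (1 : ℝ)) := measurable_const.indicator hs
  have hb : ∃ C, ∀ z, |s.indicator (fun _ => (1 : ℝ)) z| ≤ C :=
    ⟨1, fun z => by by_cases hz : z ∈ s <;> simp [hz]⟩
  have key := (h.integral_eq _ hm hb).symm.trans (h'.integral_eq _ hm hb)
  have hr : ∀ r : (Fin k → ℂ) → ℝ, ∀ z,
      s.indicator (fun _ => (1 : ℝ)) z * r z = s.indicator r z := fun r z => by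
    by_cases hz : z ∈ s <;> simp [hz]
  simp only [hr] at key
  rwa [integral_indicator hs, integral_indicator hs] at key

variable [IsProbabilityMeasure P]

/-- With the test function 1, the sum over tuples is the number of embeddings, so the total mass is
finite. -/
theorem ae_lintegral_schurIntegrand_lt_top (hM : Measurable M) (hρ : Measurable ρ)
    (hρ0 : ∀ A, 0 ≤ ρ A)
    (hlaw : P.map M = (matrixLebesgue (m + k)).withDensity fun A => ENNReal.ofReal (ρ A)) :
    ∀ᵐ z : Fin k → ℂ,
      ∫⁻ x, ENNReal.ofReal (schurIntegrand ρ z x) ∂SchurCoord.measure m k < ⊤ := by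
  have h := lintegral_tupleSum_mul hρ hρ0 (f := fun _ => 1) measurable_const
  simp only [tupleSum_one, one_mul] at h
  rw [lintegral_density hM hρ hlaw measurable_const, lintegral_const, measure_univ, mul_one] at h
  have hm : Measurable fun z : Fin k → ℂ => ENNReal.ofReal (vandermondeNormSq z) *
      ∫⁻ x, ENNReal.ofReal (schurIntegrand ρ z x) ∂SchurCoord.measure m k :=
    measurable_vandermondeNormSq.ennreal_ofReal.mul
      (measurable_schurIntegrand hρ).ennreal_ofReal.lintegral_prod_right'
  have hfin := ae_lt_top hm
    (h ▸ ENNReal.mul_ne_top ENNReal.ofReal_ne_top (ENNReal.natCast_ne_top _))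
  filter_upwards [hfin, ae_vandermondeNormSq_ne_zero k] with z hz hz0
  refine lt_top_iff_ne_top.2 fun htop => hz.ne ?_
  rw [htop, ENNReal.mul_top]
  exact (ENNReal.ofReal_pos.2 ((vandermondeNormSq_nonneg z).lt_of_ne' hz0)).ne'

theorem ae_integrable_schurIntegrand (hM : Measurable M) (hρ : Measurable ρ)
    (hρ0 : ∀ A, 0 ≤ ρ A)
    (hlaw : P.map M = (matrixLebesgue (m + k)).withDensity fun A => ENNReal.ofReal (ρ A)) :
    ∀ᵐ z : Fin k → ℂ, Integrable (schurIntegrand ρ z) (SchurCoord.measure m k) := by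
  filter_upwards [ae_lintegral_schurIntegrand_lt_top hM hρ hρ0 hlaw] with z hz
  refine ⟨((measurable_schurIntegrand hρ).comp measurable_prodMk_left).aestronglyMeasurable, ?_⟩
  rwa [hasFiniteIntegral_iff_ofReal
    (Filter.Eventually.of_forall fun x => schurIntegrand_nonneg hρ0 z x)]

theorem measurable_eigenvalueSum {n : ℕ} {f : (Fin k → ℂ) → ℝ} (hf : Measurable f) :
    Measurable (eigenvalueSum k f : Matrix (Fin n) (Fin n) ℂ → ℝ) :=
  Measurable.tupleSum_eigenvalueTuple (F := fun _ => f) (hf.comp measurable_snd) measurable_id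

/-- The defining property of the correlation function, for nonnegative functions. -/
theorem lintegral_eigenvalueSum (hM : Measurable M) (hρ : Measurable ρ)
    (hρ0 : ∀ A, 0 ≤ ρ A)
    (hlaw : P.map M = (matrixLebesgue (m + k)).withDensity fun A => ENNReal.ofReal (ρ A))
    {f : (Fin k → ℂ) → ℝ} (hf : Measurable f) (hf0 : ∀ z, 0 ≤ f z) :
    ∫⁻ ω, ENNReal.ofReal (eigenvalueSum k f (M ω)) ∂P =
      ∫⁻ z, ENNReal.ofReal (f z * schurCorrelation ρ z) := by
  have hpos : 0 < (2 * Real.pi) ^ k := by positivity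
  have h := lintegral_tupleSum_mul hρ hρ0 hf.ennreal_ofReal
  have hS : ∀ A : Matrix (Fin (m + k)) (Fin (m + k)) ℂ,
      tupleSum k (fun z => ENNReal.ofReal (f z)) (eigenvalueTuple A) =
        ENNReal.ofReal (eigenvalueSum k f A) := fun A =>
    (ENNReal.ofReal_sum_of_nonneg fun _ _ => hf0 _).symm
  simp only [hS] at h
  rw [lintegral_density hM hρ hlaw (measurable_eigenvalueSum hf).ennreal_ofReal] at h
  refine (ENNReal.mul_right_inj (ENNReal.ofReal_pos.2 hpos).ne' ENNReal.ofReal_ne_top).1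
    (h.trans ?_)
  rw [← lintegral_const_mul' _ _ ENNReal.ofReal_ne_top]
  refine lintegral_congr_ae ?_
  -- The Bochner integral defaults to 0 on divergence, so it is compared with the lower integral
  -- only at the almost all z where it converges.
  filter_upwards [ae_integrable_schurIntegrand hM hρ hρ0 hlaw] with z hz
  rw [← ofReal_integral_eq_lintegral_ofReal hz
    (Filter.Eventually.of_forall fun x => schurIntegrand_nonneg hρ0 z x),
    ← ENNReal.ofReal_mul (hf0 z),
    ← ENNReal.ofReal_mul (mul_nonneg (hf0 z) (vandermondeNormSq_nonneg z)),
    ← ENNReal.ofReal_mul hpos.le, schurCorrelation]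
  congr 1
  field_simp

theorem abs_eigenvalueSum_le {n : ℕ} {f : (Fin k → ℂ) → ℝ} {C : ℝ} (hC : ∀ z, |f z| ≤ C)
    (A : Matrix (Fin n) (Fin n) ℂ) :
    ‖eigenvalueSum k f A‖ ≤ Fintype.card (Fin k ↪ Fin n) * C := by
  refine (norm_sum_le _ _).trans ((Finset.sum_le_sum fun _ _ => hC _).trans ?_)
  simp

theorem integrable_eigenvalueSum (hM : Measurable M) {f : (Fin k → ℂ) → ℝ} (hf : Measurable f)
    (hC : ∃ C, ∀ z, |f z| ≤ C) : Integrable (fun ω => eigenvalueSum k f (M ω)) P := by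
  obtain ⟨C, hC⟩ := hC
  exact Integrable.of_bound ((measurable_eigenvalueSum hf).comp hM).aestronglyMeasurable _
    (Filter.Eventually.of_forall fun ω => abs_eigenvalueSum_le hC (M ω))

theorem integral_eigenvalueSum_of_nonneg (hM : Measurable M) (hρ : Measurable ρ)
    (hρ0 : ∀ A, 0 ≤ ρ A)
    (hlaw : P.map M = (matrixLebesgue (m + k)).withDensity fun A => ENNReal.ofReal (ρ A))
    {f : (Fin k → ℂ) → ℝ} (hf : Measurable f) (hf0 : ∀ z, 0 ≤ f z) :
    ∫ ω, eigenvalueSum k f (M ω) ∂P = ∫ z, f z * schurCorrelation ρ z := by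
  rw [integral_eq_lintegral_of_nonneg_ae, integral_eq_lintegral_of_nonneg_ae,
    lintegral_eigenvalueSum hM hρ hρ0 hlaw hf hf0]
  · exact Filter.Eventually.of_forall fun z => mul_nonneg (hf0 z) (schurCorrelation_nonneg hρ0 z)
  · exact (hf.mul (measurable_schurCorrelation hρ)).aestronglyMeasurable
  · exact Filter.Eventually.of_forall fun ω => Finset.sum_nonneg fun _ _ => hf0 _
  · exact ((measurable_eigenvalueSum hf).comp hM).aestronglyMeasurable

theorem integrable_schurCorrelation (hM : Measurable M) (hρ : Measurable ρ)
    (hρ0 : ∀ A, 0 ≤ ρ A)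
    (hlaw : P.map M = (matrixLebesgue (m + k)).withDensity fun A => ENNReal.ofReal (ρ A)) :
    Integrable (schurCorrelation ρ : (Fin k → ℂ) → ℝ) := by
  refine ⟨(measurable_schurCorrelation hρ).aestronglyMeasurable, ?_⟩
  rw [hasFiniteIntegral_iff_ofReal
    (Filter.Eventually.of_forall fun z => schurCorrelation_nonneg hρ0 z)]
  have h := lintegral_eigenvalueSum hM hρ hρ0 hlaw (f := fun _ => 1) measurable_const
    fun _ => zero_le_one
  simp only [one_mul] at h
  rw [← h]
  have hi := integrable_eigenvalueSum (P := P) hM (f := fun _ : Fin k → ℂ => (1 : ℝ))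
    measurable_const ⟨1, by simp⟩
  exact (hasFiniteIntegral_iff_ofReal (Filter.Eventually.of_forall fun ω =>
    Finset.sum_nonneg fun _ _ => zero_le_one)).1 hi.2

theorem isCorrelationFunction_schurCorrelation (hM : Measurable M) (hρ : Measurable ρ)
    (hρ0 : ∀ A, 0 ≤ ρ A)
    (hlaw : P.map M = (matrixLebesgue (m + k)).withDensity fun A => ENNReal.ofReal (ρ A)) :
    IsCorrelationFunction P M k (schurCorrelation ρ) where
  integrable := integrable_schurCorrelation hM hρ hρ0 hlaw
  integrable_eigenvalueSum f hf hC := integrable_eigenvalueSum hM hf hC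
  integral_eq f hf hC := by
    obtain ⟨C, hC⟩ := hC
    have hC0 : 0 ≤ C := (abs_nonneg _).trans (hC 0)
    -- Both f + C and C are nonnegative; integrability of the candidate allows the second identity
    -- to be subtracted from the first.
    have h1 := integral_eigenvalueSum_of_nonneg hM hρ hρ0 hlaw (f := fun z => f z + C)
      (hf.add_const C) fun z => by linarith [neg_abs_le (f z), hC z]
    have h2 := integral_eigenvalueSum_of_nonneg hM hρ hρ0 hlaw (f := fun _ => C)
      measurable_const fun _ => hC0
    have hr := integrable_schurCorrelation hM hρ hρ0 hlaw
    have hS : ∀ ω, eigenvalueSum k (fun z => f z + C) (M ω) =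
        eigenvalueSum k f (M ω) + eigenvalueSum k (fun _ => C) (M ω) := fun ω =>
      Finset.sum_add_distrib
    simp only [hS, add_mul] at h1
    rw [integral_add (integrable_eigenvalueSum hM hf ⟨C, hC⟩)
      (integrable_eigenvalueSum hM measurable_const ⟨C, fun _ => (abs_of_nonneg hC0).le⟩),
      integral_add (hr.bdd_mul hf.aestronglyMeasurable (Filter.Eventually.of_forall hC))
      (hr.const_mul C), h2] at h1
    exact add_right_cancel h1

end

end

theorem mainTheorem3 {Ω : Type*} [MeasurableSpace Ω] (P : Measure Ω) [IsProbabilityMeasure P]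
    (m k : ℕ) (M : Ω → Matrix (Fin (m + k)) (Fin (m + k)) ℂ) (hM : Measurable M)
    (ρ : Matrix (Fin (m + k)) (Fin (m + k)) ℂ → ℝ) (hρ : Measurable ρ) (hρ0 : ∀ A, 0 ≤ ρ A)
    (hlaw : P.map M = (matrixLebesgue (m + k)).withDensity fun A => ENNReal.ofReal (ρ A)) :
    (∀ᵐ z : Fin k → ℂ, Integrable (schurIntegrand ρ z) (SchurCoord.measure m k)) ∧
    IsCorrelationFunction P M k
      (fun z => vandermondeNormSq z / (2 * Real.pi) ^ k *
        ∫ x, schurIntegrand ρ z x ∂(SchurCoord.measure m k)) ∧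
    ∀ r : (Fin k → ℂ) → ℝ, IsCorrelationFunction P M k r →
      ∀ᵐ z : Fin k → ℂ, r z = vandermondeNormSq z / (2 * Real.pi) ^ k *
        ∫ x, schurIntegrand ρ z x ∂(SchurCoord.measure m k) :=
  have h := isCorrelationFunction_schurCorrelation hM hρ hρ0 hlaw
  ⟨ae_integrable_schurIntegrand hM hρ hρ0 hlaw, h, fun _ hr => hr.ae_eq h⟩
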